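/- Manifolds are smooth, Hausdorff, second countable and without boundary. A weakly-embedded submanifold of a manifold $M$ is a subset $L \subseteq M$ with a manifold structure for which the inclusion $L \hookrightarrow M$ is an immersion and for which a map from an open subset of some $\mathbb{R}^d$ to $L$ is smooth if and only if it is smooth as a map to $M$. A (Stefan) singular foliation of an $n$-dimensional manifold $M$ is a partition $\mathcal{F}$ of $M$ into connected weakly-embedded submanifolds, called leaves, such that about each $x \in M$, with $k$ the dimension of the leaf through $x$, there is a diffeomorphism $\psi : V \to U \times W$ from an open neighbourhood $V$ of $x$ onto a product of open neighbourhoods of the origin in $\mathbb{R}^k$ and $\mathbb{R}^{n-k}$, with $\psi(x) = (0,0)$, such that for each leaf $L$ we have $\psi(L \cap V) = U \times \ell$ for some $\ell \subseteq W$. A vector field is tangent to $\mathcal{F}$ if its value at each point is tangent to the leaf through that point. A differential form $\alpha$ on $M$ is $\mathcal{F}$-basic if $\iota_X \alpha = 0$ and $\mathcal{L}_X \alpha = 0$ for every smooth vector field $X$ tangent to $\mathcal{F}$. The basic forms are a subcomplex $(\Omega_b^\bullet(M,\mathcal{F}), d)$ of the de Rham complex of $M$; its cohomology $H_b^\bullet(M,\mathcal{F})$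 is the basic cohomology. If $p : M \to N$ is a surjective submersion with connected fibers and $\mathcal{F}$ is a singular foliation of $N$, then $p^{-1}\mathcal{F}$ is the partition of $M$ into the sets $p^{-1}(L)$, for $L$ a leaf of $\mathcal{F}$. Two singular foliations $(N_0, \mathcal{F}_0)$ and $(N_1, \mathcal{F}_1)$ are Molino transverse equivalent if there are a singular foliation $(M, \mathcal{F})$ and surjective submersions with connected fibers $p_i : M \to N_i$ such that $p_i^{-1}\mathcal{F}_i = \mathcal{F}$ for $i = 0, 1$. (1) Let $p : M \to N$ be a surjective submersion with connected fibers, and let $\mathcal{F}$ be a singular foliation of $N$. Then the pullback $p^*$ of forms is an isomorphism of complexes from $\Omega_b^\bullet(N, \mathcal{F})$ to $\Omega_b^\bullet(M, p^{-1}\mathcal{F})$. (2) If the singular foliations $(N_0, \mathcal{F}_0)$ and $(N_1, \mathcal{F}_1)$ are Molino transverse equivalent, then the complexes $\Omega_b^\bullet(N_0, \mathcal{F}_0)$ and $\Omega_b^\bullet(N_1, \mathcal{F}_1)$ are isomorphic, and so $H_b^k(N_0, \mathcal{F}_0) \cong H_b^k(N_1, \mathcal{F}_1)$ for every $k \geq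 0$. -/

import Mathlib

open scoped Manifold ContDiff Topology

universe u


noncomputable section

namespace Foliation

/-- Differential `k`-forms on the `n`-manifold `M`, before any smoothness is imposed: a choice of
an alternating `k`-linear form on each tangent space. -/
abbrev RawForm (n : ℕ) (M : Type u) [TopologicalSpace M] [ChartedSpace (EuclideanSpace ℝ (Fin n)) M]
    (k : ℕ) : Type u :=
  ∀ x : M, TangentSpace (𝓡 n) x [⋀^Fin k]→L[ℝ] ℝ

section
variable {n : ℕ} {M : Type u} [TopologicalSpace M] [ChartedSpace (EuclideanSpace ℝ (Fin n)) M]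

/-- The expression of a form in the preferred chart at `c`: its pullback by the inverse chart,
a form on the model space, meaningful on the target of the chart. -/
def chartRep {k : ℕ} (α : RawForm n M k) (c : M) :
    EuclideanSpace ℝ (Fin n) → EuclideanSpace ℝ (Fin n) [⋀^Fin k]→L[ℝ] ℝ := fun y =>
  (α ((extChartAt (𝓡 n) c).symm y)).compContinuousLinearMap
    (mfderiv 𝓘(ℝ, EuclideanSpace ℝ (Fin n)) (𝓡 n) (extChartAt (𝓡 n) c).symm y)

/-- A form is smooth if its expression in each preferred chart is smooth. -/
def IsSmoothForm {k : ℕ} (α : RawForm n M k) : Prop :=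
  ∀ c : M, ContDiffOn ℝ ∞ (chartRep α c) (extChartAt (𝓡 n) c).target

/-- The exterior derivative: at `x`, differentiate the expression of the form in the chart at `x`
and transport the result back by the derivative of the chart. By `chartRep_rawD` below, any other
chart gives the same result. -/
def rawD {k : ℕ} (α : RawForm n M k) : RawForm n M (k + 1) := fun x =>
  (extDeriv (chartRep α x) (extChartAt (𝓡 n) x x)).compContinuousLinearMap
    (mfderiv (𝓡 n) 𝓘(ℝ, EuclideanSpace ℝ (Fin n)) (extChartAt (𝓡 n) x) x)

theorem chartRep_apply {k : ℕ} (α : RawForm n M k) (c : M) (y : EuclideanSpace ℝ (Fin n))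
    (v : Fin k → EuclideanSpace ℝ (Fin n)) :
    chartRep α c y v = α ((extChartAt (𝓡 n) c).symm y) (fun i =>
    mfderiv 𝓘(ℝ, EuclideanSpace ℝ (Fin n)) (𝓡 n) (extChartAt (𝓡 n) c).symm y (v i)) := rfl

theorem chartRep_add {k : ℕ} (α η : RawForm n M k) (c : M) :
    chartRep (α + η) c = chartRep α c + chartRep η c := rfl

theorem chartRep_smul {k : ℕ} (a : ℝ) (α : RawForm n M k) (c : M) :
    chartRep (a • α) c = a • chartRep α c := rfl

/-- The pullback of a raw form by a map from the model space, at a point. -/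
def pullAt {k : ℕ} (α : RawForm n M k) (g : EuclideanSpace ℝ (Fin n) → M)
    (y : EuclideanSpace ℝ (Fin n)) : EuclideanSpace ℝ (Fin n) [⋀^Fin k]→L[ℝ] ℝ :=
  (α (g y)).compContinuousLinearMap (mfderiv 𝓘(ℝ, EuclideanSpace ℝ (Fin n)) (𝓡 n) g y)

theorem pullAt_congr {k : ℕ} (α : RawForm n M k) {g g' : EuclideanSpace ℝ (Fin n) → M}
    {y : EuclideanSpace ℝ (Fin n)} (h : g =ᶠ[𝓝 y] g') : pullAt α g y = pullAt α g' y := by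
  have key : ∀ (F : M → (Fin k → EuclideanSpace ℝ (Fin n)) → ℝ) (a b : M) (_ : a = b)
      (A B : EuclideanSpace ℝ (Fin n) →L[ℝ] EuclideanSpace ℝ (Fin n)) (_ : A = B)
      (v : Fin k → EuclideanSpace ℝ (Fin n)),
      F a (fun i => A (v i)) = F b (fun i => B (v i)) := by
    rintro F a _ rfl A _ rfl v
    rfl
  ext v
  exact key (fun a w => α a w) _ _ h.eq_of_nhds _ _ h.mfderiv_eq v

theorem IsSmoothForm.differentiableAt {k : ℕ} {α : RawForm n M k} (hα : IsSmoothForm α) (c : M)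
    {y : EuclideanSpace ℝ (Fin n)} (hy : y ∈ (extChartAt (𝓡 n) c).target) :
    DifferentiableAt ℝ (chartRep α c) y :=
  ((hα c).contDiffAt ((isOpen_extChartAt_target c).mem_nhds hy)).differentiableAt (by simp)

theorem rawD_smul {k : ℕ} (a : ℝ) (α : RawForm n M k) : rawD (a • α) = a • rawD α := by
  funext x
  have h : extDeriv (chartRep (a • α) x) (extChartAt (𝓡 n) x x) = _ :=
    extDeriv_smul a (chartRep α x)
  unfold rawD
  rw [h]
  rfl

variable [IsManifold (𝓡 n) ∞ M]

/-- The exterior derivative is computed by the Euclidean one in every chart. -/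
theorem chartRep_rawD {k : ℕ} {α : RawForm n M k} (hα : IsSmoothForm α) (c : M)
    {y : EuclideanSpace ℝ (Fin n)} (hy : y ∈ (extChartAt (𝓡 n) c).target) :
    chartRep (rawD α) c y = extDeriv (chartRep α c) y := by
  set z : M := (extChartAt (𝓡 n) c).symm y with hz
  set τ : EuclideanSpace ℝ (Fin n) → EuclideanSpace ℝ (Fin n) :=
    extChartAt (𝓡 n) z ∘ (extChartAt (𝓡 n) c).symm with hτ
  have hOc : IsOpen (extChartAt (𝓡 n) c).target := isOpen_extChartAt_target c
  have hev : ∀ᶠ y' in 𝓝 y, y' ∈ (extChartAt (𝓡 n) c).target ∧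
      (extChartAt (𝓡 n) c).symm y' ∈ (extChartAt (𝓡 n) z).source := by
    refine (hOc.eventually_mem hy).and ?_
    have hc : ContinuousAt (extChartAt (𝓡 n) c).symm y :=
      (contMDiffOn_extChartAt_symm (I := 𝓡 n) (n := ∞) c).continuousOn.continuousAt
        (hOc.mem_nhds hy)
    refine hc.eventually_mem ?_
    exact (isOpen_extChartAt_source z).mem_nhds (mem_extChartAt_source z)
  have hsm : ∀ y', y' ∈ (extChartAt (𝓡 n) c).target →
      MDifferentiableAt 𝓘(ℝ, EuclideanSpace ℝ (Fin n)) (𝓡 n) (extChartAt (𝓡 n) c).symm y' := by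
    intro y' hy'
    exact ((contMDiffOn_extChartAt_symm (n := ∞) c).contMDiffAt (hOc.mem_nhds hy')).mdifferentiableAt
      (by simp)
  have hch : ∀ x, x ∈ (extChartAt (𝓡 n) z).source →
      MDifferentiableAt (𝓡 n) 𝓘(ℝ, EuclideanSpace ℝ (Fin n)) (extChartAt (𝓡 n) z) x := by
    intro x hx
    exact mdifferentiableAt_extChartAt (by simpa using hx)
  have hτs : ∀ y', y' ∈ (extChartAt (𝓡 n) c).target →
      (extChartAt (𝓡 n) c).symm y' ∈ (extChartAt (𝓡 n) z).source → ContDiffAt ℝ ∞ τ y' := by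
    intro y' h1 h2
    rw [← contMDiffAt_iff_contDiffAt]
    exact ((contMDiffOn_extChartAt (n := ∞) (x := z)).contMDiffAt
      ((chartAt (EuclideanSpace ℝ (Fin n)) z).open_source.mem_nhds (by simpa using h2))).comp y'
      ((contMDiffOn_extChartAt_symm (n := ∞) c).contMDiffAt (hOc.mem_nhds h1))
  have hrep : chartRep α c =ᶠ[𝓝 y] fun y' =>
      (chartRep α z (τ y')).compContinuousLinearMap (fderiv ℝ τ y') := by
    filter_upwards [hev, hev.eventually_nhds] with y' hy' hyn
    have h3 : (extChartAt (𝓡 n) z).symm (τ y') = (extChartAt (𝓡 n) c).symm y' :=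
      (extChartAt (𝓡 n) z).left_inv hy'.2
    have hτy : τ y' ∈ (extChartAt (𝓡 n) z).target := (extChartAt (𝓡 n) z).map_source hy'.2
    have hz' : MDifferentiableAt 𝓘(ℝ, EuclideanSpace ℝ (Fin n)) (𝓡 n)
        (extChartAt (𝓡 n) z).symm (τ y') :=
      ((contMDiffOn_extChartAt_symm (n := ∞) z).contMDiffAt
        ((isOpen_extChartAt_target z).mem_nhds hτy)).mdifferentiableAt (by simp)
    have hτd : MDifferentiableAt 𝓘(ℝ, EuclideanSpace ℝ (Fin n)) 𝓘(ℝ, EuclideanSpace ℝ (Fin n)) τ y' :=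
      ((hτs y' hy'.1 hy'.2).differentiableAt (by simp)).mdifferentiableAt
    have hcomp := mfderiv_comp y' hz' hτd
    rw [mfderiv_eq_fderiv] at hcomp
    have hee : (extChartAt (𝓡 n) c).symm =ᶠ[𝓝 y'] (extChartAt (𝓡 n) z).symm ∘ τ := by
      filter_upwards [hyn] with w hw
      exact ((extChartAt (𝓡 n) z).left_inv hw.2).symm
    refine (pullAt_congr α hee).trans ?_
    unfold pullAt
    rw [hcomp]
    rfl
  have hD : fderiv ℝ τ y = (mfderiv (𝓡 n) 𝓘(ℝ, EuclideanSpace ℝ (Fin n)) (extChartAt (𝓡 n) z) z).comp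
      (mfderiv 𝓘(ℝ, EuclideanSpace ℝ (Fin n)) (𝓡 n) (extChartAt (𝓡 n) c).symm y) := by
    rw [← mfderiv_eq_fderiv]
    exact mfderiv_comp y (hch _ (mem_extChartAt_source z)) (hsm y hy)
  have hdiff : DifferentiableAt ℝ (chartRep α z) (τ y) :=
    ((hα z).contDiffAt ((isOpen_extChartAt_target z).mem_nhds (mem_extChartAt_target z))).differentiableAt
      (by simp)
  rw [hrep.extDeriv_eq, extDeriv_pullback hdiff (hτs y hy (mem_extChartAt_source z)) (by simpa using WithTop.coe_le_coe.2 (le_top : (2 : ℕ∞) ≤ ⊤)), hD]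
  rfl



theorem IsSmoothForm.rawD {k : ℕ} {α : RawForm n M k} (hα : IsSmoothForm α) :
    IsSmoothForm (rawD α) := by
  intro c
  have h1 : ContDiffOn ℝ ∞ (fderiv ℝ (chartRep α c)) (extChartAt (𝓡 n) c).target :=
    (hα c).fderiv_of_isOpen (isOpen_extChartAt_target c) (by simp)
  have h2 := (ContinuousAlternatingMap.alternatizeUncurryFinCLM (n := k) ℝ
    (EuclideanSpace ℝ (Fin n)) ℝ).contDiff (n := ∞) |>.comp_contDiffOn h1
  exact h2.congr fun y hy => chartRep_rawD hα c hy

theorem rawD_rawD {k : ℕ} {α : RawForm n M k} (hα : IsSmoothForm α) :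
    rawD (rawD α) = 0 := by
  funext x
  have hx := mem_extChartAt_target (I := 𝓡 n) x
  have hev : chartRep (rawD α) x =ᶠ[𝓝 (extChartAt (𝓡 n) x x)] extDeriv (chartRep α x) := by
    filter_upwards [(isOpen_extChartAt_target x).mem_nhds hx] with y hy
    exact chartRep_rawD hα x hy
  have h0 : extDeriv (chartRep (rawD α) x) (extChartAt (𝓡 n) x x) = 0 := by
    rw [hev.extDeriv_eq]
    exact extDeriv_extDeriv_apply
      ((hα x).contDiffAt ((isOpen_extChartAt_target x).mem_nhds hx))
      (by simpa using WithTop.coe_le_coe.2 (le_top : (2 : ℕ∞) ≤ ⊤))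
  ext v
  change extDeriv (chartRep (rawD α) x) (extChartAt (𝓡 n) x x) _ = 0
  rw [h0]
  rfl

theorem rawD_add {k : ℕ} {α β : RawForm n M k} (hα : IsSmoothForm α) (hβ : IsSmoothForm β) :
    rawD (α + β) = rawD α + rawD β := by
  funext x
  have hx := mem_extChartAt_target (I := 𝓡 n) x
  have h : extDeriv (chartRep (α + β) x) (extChartAt (𝓡 n) x x) = _ :=
    extDeriv_add (hα.differentiableAt x hx) (hβ.differentiableAt x hx)
  unfold rawD
  rw [h]
  rfl

end

section
variable {n : ℕ} {M : Type u} [TopologicalSpace M] [ChartedSpace (EuclideanSpace ℝ (Fin n)) M]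
  [IsManifold (𝓡 n) ∞ M]

/-- Vector fields on `M`, before any smoothness is imposed. -/
abbrev VField (n : ℕ) (M : Type u) [TopologicalSpace M]
    [ChartedSpace (EuclideanSpace ℝ (Fin n)) M] : Type u :=
  ∀ x : M, TangentSpace (𝓡 n) x

/-- Smooth vector fields: smooth sections of the tangent bundle. -/
def IsSmoothField (X : VField n M) : Prop :=
  ContMDiff (𝓡 n) (𝓡 n).tangent ∞ fun x => (⟨x, X x⟩ : TangentBundle (𝓡 n) M)

/-- `ι_X α = 0`; for a `0`-form the contraction is zero by convention. -/
def ContractionVanishes (X : VField n M) : ∀ {k : ℕ}, RawForm n M k → Prop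
  | 0, _ => True
  | k + 1, α => ∀ (x : M) (v : Fin k → TangentSpace (𝓡 n) x),
      α x (Fin.cons (X x) v : Fin (k + 1) → TangentSpace (𝓡 n) x) = 0

/-- The Lie derivative of a form along a vector field on a normed space, in coordinates:
`(L_X a) (v₁, …, vₖ) = (D_X a) (v₁, …, vₖ) + ∑ i, a (v₁, …, D_{v_i} X, …, vₖ)`. -/
def modelLie {V : Type*} [NormedAddCommGroup V] [NormedSpace ℝ V] {k : ℕ}
    (X : V → V) (a : V → V [⋀^Fin k]→L[ℝ] ℝ) (y : V) (v : Fin k → V) : ℝ :=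
  fderiv ℝ a y (X y) v + ∑ i, a y (Function.update v i (fderiv ℝ X y (v i)))

/-- The expression of a vector field in the preferred chart at `c`: its pullback by the inverse
chart. -/
def fieldRep (X : VField n M) (c : M) : EuclideanSpace ℝ (Fin n) → EuclideanSpace ℝ (Fin n) :=
  VectorField.mpullback 𝓘(ℝ, EuclideanSpace ℝ (Fin n)) (𝓡 n) (extChartAt (𝓡 n) c).symm X

/-- The Lie derivative `L_X α` of a form along a vector field: at `x`, it is computed in the chart
at `x` by the coordinate formula. -/
def lieD {k : ℕ} (X : VField n M) (α : RawForm n M k) (x : M)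
    (v : Fin k → TangentSpace (𝓡 n) x) : ℝ :=
  modelLie (fieldRep X x) (chartRep α x) (extChartAt (𝓡 n) x x) fun i =>
    mfderiv (𝓡 n) 𝓘(ℝ, EuclideanSpace ℝ (Fin n)) (extChartAt (𝓡 n) x) x (v i)

theorem modelLie_add {V : Type*} [NormedAddCommGroup V] [NormedSpace ℝ V] {k : ℕ}
    (X : V → V) {a b : V → V [⋀^Fin k]→L[ℝ] ℝ} {y : V} (ha : DifferentiableAt ℝ a y)
    (hb : DifferentiableAt ℝ b y) (v : Fin k → V) :
    modelLie X (a + b) y v = modelLie X a y v + modelLie X b y v := by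
  simp only [modelLie]
  rw [fderiv_add ha hb]
  simp only [Pi.add_apply, ContinuousAlternatingMap.add_apply, Finset.sum_add_distrib,
    add_apply]
  ring

theorem modelLie_smul {V : Type*} [NormedAddCommGroup V] [NormedSpace ℝ V] {k : ℕ}
    (X : V → V) (r : ℝ) {a : V → V [⋀^Fin k]→L[ℝ] ℝ} {y : V} (ha : DifferentiableAt ℝ a y)
    (v : Fin k → V) : modelLie X (r • a) y v = r * modelLie X a y v := by
  simp only [modelLie]
  rw [fderiv_const_smul ha]
  simp [mul_add, Finset.mul_sum]

/-- The formula `ι_X (d a) = L_X a` when `ι_X a = 0`. -/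
theorem modelLie_eq {V : Type*} [NormedAddCommGroup V] [NormedSpace ℝ V] {k : ℕ}
    {X : V → V} {a : V → V [⋀^Fin (k + 1)]→L[ℝ] ℝ} {y : V} (hX : DifferentiableAt ℝ X y)
    (ha : DifferentiableAt ℝ a y)
    (h0 : ∀ᶠ z in 𝓝 y, ∀ v : Fin k → V, a z (Fin.cons (X z) v : Fin (k + 1) → V) = 0)
    (v : Fin (k + 1) → V) :
    extDeriv a y (Fin.cons (X y) v : Fin (k + 2) → V) = modelLie X a y v := by
  have hd : ∀ i : Fin (k + 1), fderiv ℝ a y (v i) (Fin.cons (X y) (i.removeNth v)) =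
      - a y (Fin.cons (fderiv ℝ X y (v i)) (i.removeNth v)) := by
    intro i
    have hg : ∀ j : Fin (k + 1), DifferentiableAt ℝ
        (fun z => (Fin.cons (X z) (i.removeNth v) : Fin (k + 1) → V) j) y := by
      intro j
      refine Fin.cases ?_ (fun j => ?_) j
      · simpa using hX
      · simp
    have h1 := fderiv_continuousAlternatingMap_apply_apply ha hg (v i)
    have h2 : (fun z => a z fun j => (Fin.cons (X z) (i.removeNth v) : Fin (k + 1) → V) j)
        =ᶠ[𝓝 y] fun _ => 0 := by
      filter_upwards [h0] with z hz using hz _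
    rw [h2.fderiv_eq, Fin.sum_univ_succ] at h1
    simp only [Fin.cons_zero, Fin.cons_succ, fderiv_fun_const, Pi.zero_apply, zero_apply,
      Fin.update_cons_zero] at h1
    have h3 : ∀ j : Fin k, a y (Function.update (Fin.cons (X y) (i.removeNth v) : Fin (k + 1) → V)
        j.succ 0) = 0 := fun j => (a y).map_update_zero _ _
    simp only [h3, Finset.sum_const_zero, add_zero] at h1
    exact eq_neg_of_add_eq_zero_left h1.symm
  rw [extDeriv, ContinuousAlternatingMap.alternatizeUncurryFin_apply, Fin.sum_univ_succ]
  unfold modelLie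
  congr 1
  · simp
  · refine Finset.sum_congr rfl fun i _ => ?_
    have hr : Fin.removeNth i.succ (Fin.cons (X y) v : Fin (k + 2) → V) =
        (Fin.cons (X y) (i.removeNth v) : Fin (k + 1) → V) := by
      funext j
      refine Fin.cases ?_ (fun j => ?_) j <;> simp [Fin.removeNth]
    rw [hr, Fin.cons_succ, hd, ← Fin.insertNth_removeNth, ContinuousAlternatingMap.map_insertNth,
      Fin.val_succ, pow_succ]
    simp [Matrix.vecCons]


theorem isInvertible_symm (c : M) {y : EuclideanSpace ℝ (Fin n)}
    (hy : y ∈ (extChartAt (𝓡 n) c).target) :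
    (mfderiv 𝓘(ℝ, EuclideanSpace ℝ (Fin n)) (𝓡 n) (extChartAt (𝓡 n) c).symm y).IsInvertible := by
  have h := isInvertible_mfderivWithin_extChartAt_symm (I := 𝓡 n) hy
  rwa [ModelWithCorners.range_eq_univ, mfderivWithin_univ] at h

theorem chartRep_cons {k : ℕ} (α : RawForm n M (k + 1)) (X : VField n M) (c : M)
    {y : EuclideanSpace ℝ (Fin n)} (hy : y ∈ (extChartAt (𝓡 n) c).target)
    (v : Fin k → EuclideanSpace ℝ (Fin n)) :
    chartRep α c y (Fin.cons (fieldRep X c y) v : Fin (k + 1) → EuclideanSpace ℝ (Fin n)) =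
      α ((extChartAt (𝓡 n) c).symm y) (Fin.cons (X ((extChartAt (𝓡 n) c).symm y)) (fun i =>
        mfderiv 𝓘(ℝ, EuclideanSpace ℝ (Fin n)) (𝓡 n) (extChartAt (𝓡 n) c).symm y (v i)) :
        Fin (k + 1) → TangentSpace (𝓡 n) ((extChartAt (𝓡 n) c).symm y)) := by
  rw [chartRep_apply]
  congr 1
  funext i
  refine Fin.cases ?_ (fun j => ?_) i
  · exact (isInvertible_symm c hy).self_apply_inverse _
  · rfl

theorem fieldRep_self (X : VField n M) (x : M) :
    fieldRep X x (extChartAt (𝓡 n) x x) =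
      mfderiv (𝓡 n) 𝓘(ℝ, EuclideanSpace ℝ (Fin n)) (extChartAt (𝓡 n) x) x (X x) := by
  have h1 : ∀ v : TangentSpace (𝓡 n) x, (mfderiv 𝓘(ℝ, EuclideanSpace ℝ (Fin n)) (𝓡 n)
      (extChartAt (𝓡 n) x).symm (extChartAt (𝓡 n) x x)).inverse v = v := by
    have h := mfderivWithin_extChartAt_symm_inverse_apply (I := 𝓡 n) (x := x)
    rwa [ModelWithCorners.range_eq_univ, mfderivWithin_univ] at h
  have h2 : (X ((extChartAt (𝓡 n) x).symm (extChartAt (𝓡 n) x x)) : EuclideanSpace ℝ (Fin n)) =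
      X x := congrArg (fun a => (X a : EuclideanSpace ℝ (Fin n))) (extChartAt_to_inv x)
  rw [mfderiv_extChartAt_self]
  exact (h1 _).trans h2

theorem differentiableAt_fieldRep {X : VField n M} (hX : IsSmoothField X) (c : M)
    {y : EuclideanSpace ℝ (Fin n)} (hy : y ∈ (extChartAt (𝓡 n) c).target) :
    DifferentiableAt ℝ (fieldRep X c) y := by
  have h := ContMDiffAt.mpullback_vectorField_preimage (m := 1) (n := ∞)
    (I := 𝓘(ℝ, EuclideanSpace ℝ (Fin n))) (I' := 𝓡 n) (f := (extChartAt (𝓡 n) c).symm)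
    (x₀ := y) (V := X) ((hX _).of_le (by simp))
    ((contMDiffOn_extChartAt_symm (n := ∞) c).contMDiffAt
      ((isOpen_extChartAt_target c).mem_nhds hy)) (isInvertible_symm c hy) (by
        simpa using WithTop.coe_le_coe.2 (le_top : ((1 : ℕ∞) + 1) ≤ ⊤))
  exact (contMDiffAt_vectorSpace_iff_contDiffAt.1 h).differentiableAt (by simp)

theorem contractionVanishes_chart {k : ℕ} {α : RawForm n M (k + 1)} {X : VField n M}
    (h : ContractionVanishes X α) (c : M) :
    ∀ y ∈ (extChartAt (𝓡 n) c).target, ∀ v : Fin k → EuclideanSpace ℝ (Fin n),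
      chartRep α c y (Fin.cons (fieldRep X c y) v :
        Fin (k + 1) → EuclideanSpace ℝ (Fin n)) = 0 := fun y hy v => by
  rw [chartRep_cons α X c hy]
  exact h _ _

theorem modelLie_zero_form {V : Type*} [NormedAddCommGroup V] [NormedSpace ℝ V]
    {X : V → V} {a : V → V [⋀^Fin 0]→L[ℝ] ℝ} {y : V} (v : Fin 0 → V) :
    extDeriv a y (Fin.cons (X y) v : Fin 1 → V) = modelLie X a y v := by
  rw [extDeriv, ContinuousAlternatingMap.alternatizeUncurryFin_apply]
  simp [modelLie]

theorem rawD_cons {k : ℕ} {α : RawForm n M k} {X : VField n M} (hα : IsSmoothForm α)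
    (hX : IsSmoothField X) (h : ContractionVanishes X α) (x : M)
    (v : Fin k → TangentSpace (𝓡 n) x) :
    rawD α x (Fin.cons (X x) v : Fin (k + 1) → TangentSpace (𝓡 n) x) = lieD X α x v := by
  have hx := mem_extChartAt_target (I := 𝓡 n) x
  have h1 : ∀ w : Fin k → EuclideanSpace ℝ (Fin n),
      extDeriv (chartRep α x) (extChartAt (𝓡 n) x x) (Fin.cons (fieldRep X x
        (extChartAt (𝓡 n) x x)) w : Fin (k + 1) → EuclideanSpace ℝ (Fin n)) =
      modelLie (fieldRep X x) (chartRep α x) (extChartAt (𝓡 n) x x) w := by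
    intro w
    cases k with
    | zero => exact modelLie_zero_form w
    | succ k =>
      refine modelLie_eq (differentiableAt_fieldRep hX x hx) (hα.differentiableAt x hx) ?_ w
      filter_upwards [(isOpen_extChartAt_target x).mem_nhds hx] with y hy
      exact contractionVanishes_chart h x y hy
  refine Eq.trans ?_ (h1 fun i =>
    mfderiv (𝓡 n) 𝓘(ℝ, EuclideanSpace ℝ (Fin n)) (extChartAt (𝓡 n) x) x (v i))
  change extDeriv (chartRep α x) (extChartAt (𝓡 n) x x) _ = _
  congr 1
  funext i
  refine Fin.cases ?_ (fun j => ?_) i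
  · exact (fieldRep_self X x).symm
  · rfl

theorem contractionVanishes_rawD {k : ℕ} {α : RawForm n M k} {X : VField n M}
    (hα : IsSmoothForm α) (hX : IsSmoothField X) (h : ContractionVanishes X α)
    (hL : ∀ x v, lieD X α x v = 0) : ContractionVanishes X (rawD α) := fun x v => by
  rw [rawD_cons hα hX h, hL]

theorem lieD_rawD {k : ℕ} {α : RawForm n M k} {X : VField n M}
    (hα : IsSmoothForm α) (hX : IsSmoothField X) (h : ContractionVanishes X α)
    (hL : ∀ x v, lieD X α x v = 0) (x : M) (v : Fin (k + 1) → TangentSpace (𝓡 n) x) :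
    lieD X (rawD α) x v = 0 := by
  rw [← rawD_cons hα.rawD hX (contractionVanishes_rawD hα hX h hL), rawD_rawD hα]
  rfl

/-- The tangent space at `x` to the leaf of `F` through `x`: the velocities at `x` of smooth curves
of `M` that stay in the leaf. If the leaf is a weakly-embedded submanifold, this is the image of the
derivative of its inclusion, see `mem_leafTangent_iff`. Partitions are given as equivalence
relations; the leaf through `x` is `{y | F y x}`. -/
def leafTangent (n : ℕ) {M : Type u} [TopologicalSpace M]
    [ChartedSpace (EuclideanSpace ℝ (Fin n)) M] (F : Setoid M) (x : M) :
    Set (TangentSpace (𝓡 n) x) :=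
  {v | ∃ γ : ℝ → M, ContMDiff 𝓘(ℝ, ℝ) (𝓡 n) ∞ γ ∧ (∀ t, F (γ t) x) ∧
    tangentMap 𝓘(ℝ, ℝ) (𝓡 n) γ ⟨0, (1 : ℝ)⟩ = ⟨x, v⟩}

/-- Smooth vector fields tangent to `F`. -/
def IsTangentField (F : Setoid M) (X : VField n M) : Prop :=
  IsSmoothField X ∧ ∀ x, X x ∈ leafTangent n F x

/-- Basic forms: horizontal and invariant for every vector field tangent to `F`. -/
def IsBasic (F : Setoid M) {k : ℕ} (α : RawForm n M k) : Prop :=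
  ∀ X : VField n M, IsTangentField F X →
    ContractionVanishes X α ∧ ∀ x v, lieD X α x v = 0

theorem lieD_add {k : ℕ} {α β : RawForm n M k} (hα : IsSmoothForm α) (hβ : IsSmoothForm β)
    (X : VField n M) (x : M) (v : Fin k → TangentSpace (𝓡 n) x) :
    lieD X (α + β) x v = lieD X α x v + lieD X β x v := by
  exact modelLie_add _ (hα.differentiableAt x (mem_extChartAt_target x))
    (hβ.differentiableAt x (mem_extChartAt_target x)) _

theorem lieD_smul {k : ℕ} (a : ℝ) {α : RawForm n M k} (hα : IsSmoothForm α)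
    (X : VField n M) (x : M) (v : Fin k → TangentSpace (𝓡 n) x) :
    lieD X (a • α) x v = a * lieD X α x v := by
  exact modelLie_smul _ a (hα.differentiableAt x (mem_extChartAt_target x)) _

variable (n) in
/-- The smooth basic `k`-forms of a partition `F`. -/
def basicForms (F : Setoid M) (k : ℕ) : Submodule ℝ (RawForm n M k) where
  carrier := {α | IsSmoothForm α ∧ IsBasic F α}
  zero_mem' := by
    have h0 : ∀ c : M, chartRep (0 : RawForm n M k) c = 0 := fun c => rfl
    have hs : IsSmoothForm (0 : RawForm n M k) := fun c => by
      rw [h0]; exact contDiffOn_const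
    refine ⟨hs, fun X _ => ⟨?_, fun x v => ?_⟩⟩
    · cases k with
      | zero => trivial
      | succ k => exact fun x v => rfl
    · have h := lieD_smul 0 hs X x v
      rwa [zero_smul, zero_mul] at h
  add_mem' := by
    rintro α β ⟨hα, hα'⟩ ⟨hβ, hβ'⟩
    refine ⟨fun c => (hα c).add (hβ c), fun X hX => ⟨?_, fun x v => ?_⟩⟩
    · cases k with
      | zero => trivial
      | succ k =>
        intro x v
        change α x _ + β x _ = 0
        rw [(hα' X hX).1 x v, (hβ' X hX).1 x v, add_zero]
    · rw [lieD_add hα hβ, (hα' X hX).2, (hβ' X hX).2, add_zero]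
  smul_mem' := by
    rintro a α ⟨hα, hα'⟩
    refine ⟨fun c => (hα c).const_smul a, fun X hX => ⟨?_, fun x v => ?_⟩⟩
    · cases k with
      | zero => trivial
      | succ k =>
        intro x v
        change a • α x _ = 0
        rw [(hα' X hX).1 x v, smul_zero]
    · rw [lieD_smul a hα, (hα' X hX).2, mul_zero]

variable (n) in
/-- The exterior derivative restricts to basic forms. -/
def basicD (F : Setoid M) (k : ℕ) : basicForms n F k →ₗ[ℝ] basicForms n F (k + 1) where
  toFun α := ⟨rawD α.1, α.2.1.rawD, fun X hX =>
    ⟨contractionVanishes_rawD α.2.1 hX.1 (α.2.2 X hX).1 (α.2.2 X hX).2,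
      lieD_rawD α.2.1 hX.1 (α.2.2 X hX).1 (α.2.2 X hX).2⟩⟩
  map_add' α β := Subtype.ext (rawD_add α.2.1 β.2.1)
  map_smul' a α := Subtype.ext (rawD_smul a α.1)

open CategoryTheory in
variable (n) in
/-- The complex of basic forms, in degrees `0, 1, 2, …`, with the exterior derivative. -/
def basicComplex (F : Setoid M) : CochainComplex (ModuleCat.{u} ℝ) ℕ :=
  CochainComplex.of (fun k => ModuleCat.of ℝ (basicForms n F k))
    (fun k => ModuleCat.ofHom (basicD n F k)) fun k => by
      ext α
      exact congrArg (fun η : RawForm n M (k + 1 + 1) => η _ _) (rawD_rawD α.2.1)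

variable (n) in
/-- The basic cohomology in degree `k`. -/
def basicCohomology (F : Setoid M) (k : ℕ) : ModuleCat.{u} ℝ :=
  (basicComplex n F).homology k


/-- The pullback `p^* α` of a form by a map `p : M → N`. -/
def pullbackForm {m : ℕ} {N : Type u} [TopologicalSpace N]
    [ChartedSpace (EuclideanSpace ℝ (Fin m)) N] (p : M → N) {k : ℕ} (α : RawForm m N k) :
    RawForm n M k := fun x =>
  (α (p x)).compContinuousLinearMap (mfderiv (𝓡 n) (𝓡 m) p x)

end

section
variable {k n : ℕ} {S M : Type u} [TopologicalSpace S] [ChartedSpace (EuclideanSpace ℝ (Fin k)) S]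
  [TopologicalSpace M] [ChartedSpace (EuclideanSpace ℝ (Fin n)) M]

variable (k n) in
/-- An injective immersion `ι : S → M` which identifies the manifold diffeology of `S` with the
subspace diffeology of its image: a map from an open subset of a Cartesian space to `S` is smooth if
and only if it is smooth as a map to `M`. -/
structure IsWeakEmbedding (ι : S → M) : Prop where
  injective : Function.Injective ι
  isImmersion : Manifold.IsImmersion (𝓡 k) (𝓡 n) ∞ ι
  plots : ∀ (d : ℕ) (U : Set (EuclideanSpace ℝ (Fin d))) (f : EuclideanSpace ℝ (Fin d) → S),
    IsOpen U → (ContMDiffOn (𝓡 d) (𝓡 k) ∞ f U ↔ ContMDiffOn (𝓡 d) (𝓡 n) ∞ (ι ∘ f) U)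

theorem mk_congr {S : Type*} [TopologicalSpace S] [ChartedSpace (EuclideanSpace ℝ (Fin k)) S]
    (v : EuclideanSpace ℝ (Fin k)) {a b : S} (h : a = b) :
    (⟨a, v⟩ : TangentBundle (𝓡 k) S) = ⟨b, v⟩ := by
  subst h; rfl

theorem exists_model_curve {V : Type*} [NormedAddCommGroup V] [NormedSpace ℝ V]
    {O : Set V} (hO : IsOpen O) {y : V} (hy : y ∈ O) (w : V) :
    ∃ f : ℝ → V, ContDiff ℝ ∞ f ∧ (∀ t, f t ∈ O) ∧ f 0 = y ∧ HasDerivAt f w 0 := by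
  obtain ⟨ε, hε, hball⟩ := Metric.isOpen_iff.1 hO y hy
  have hw1 : 0 < ‖w‖ + 1 := by positivity
  obtain ⟨r, hr⟩ : ∃ r : ℝ, r = ε / (‖w‖ + 1) := ⟨_, rfl⟩
  have hr0 : 0 < r := by rw [hr]; positivity
  refine ⟨fun t => y + (r * Real.sin (t / r)) • w, by fun_prop, fun t => hball ?_, by simp, ?_⟩
  · rw [Metric.mem_ball, dist_eq_norm]
    simp only [add_sub_cancel_left, norm_smul, norm_mul, Real.norm_eq_abs, abs_of_pos hr0]
    have h1 : r * |Real.sin (t / r)| * ‖w‖ ≤ r * ‖w‖ := by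
      gcongr
      exact mul_le_of_le_one_right hr0.le (Real.abs_sin_le_one _)
    have h2 : r * (‖w‖ + 1) = ε := by rw [hr]; field_simp
    linarith
  · have h1 : HasDerivAt (fun t : ℝ => r * Real.sin (t / r)) 1 0 := by
      have h := ((Real.hasDerivAt_sin ((0 : ℝ) / r)).comp 0
        ((hasDerivAt_id (0 : ℝ)).div_const r)).const_mul r
      simpa [hr0.ne', Function.comp_def] using h
    simpa using (h1.smul_const w).const_add y

/-- Every tangent vector of a manifold is the velocity of a smooth curve. -/
theorem exists_curve [IsManifold (𝓡 k) ∞ S] (s : S) (w : TangentSpace (𝓡 k) s) :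
    ∃ σ : ℝ → S, ContMDiff 𝓘(ℝ, ℝ) (𝓡 k) ∞ σ ∧
      tangentMap 𝓘(ℝ, ℝ) (𝓡 k) σ ⟨0, (1 : ℝ)⟩ = ⟨s, w⟩ := by
  let w' : EuclideanSpace ℝ (Fin k) := w
  obtain ⟨f, hf, hft, h0, hf'⟩ := exists_model_curve (isOpen_extChartAt_target (I := 𝓡 k) s)
    (mem_extChartAt_target s) w'
  have hsy : ∀ y ∈ (extChartAt (𝓡 k) s).target,
      ContMDiffAt 𝓘(ℝ, EuclideanSpace ℝ (Fin k)) (𝓡 k) ∞ (extChartAt (𝓡 k) s).symm y :=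
    fun y hy => (contMDiffOn_extChartAt_symm (n := ∞) s).contMDiffAt
      ((isOpen_extChartAt_target s).mem_nhds hy)
  refine ⟨(extChartAt (𝓡 k) s).symm ∘ f, fun t => (hsy _ (hft t)).comp t
    hf.contMDiff.contMDiffAt, ?_⟩
  rw [tangentMap_comp_at _ ((hsy _ (hft 0)).mdifferentiableAt (by simp))
    (hf.contMDiff.contMDiffAt.mdifferentiableAt (by simp))]
  have h1 : tangentMap 𝓘(ℝ, ℝ) 𝓘(ℝ, EuclideanSpace ℝ (Fin k)) f ⟨0, (1 : ℝ)⟩ =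
      ⟨extChartAt (𝓡 k) s s, w'⟩ := by
    have h2 : mfderiv 𝓘(ℝ, ℝ) 𝓘(ℝ, EuclideanSpace ℝ (Fin k)) f 0 (1 : ℝ) = w' := by
      rw [mfderiv_eq_fderiv]
      exact hf'.deriv
    refine Eq.trans ?_ (mk_congr w' h0)
    exact congrArg (fun q => (⟨f 0, q⟩ : TangentBundle _ (EuclideanSpace ℝ (Fin k)))) h2
  rw [h1]
  have h3 := mfderivWithin_range_extChartAt_symm (I := 𝓡 k) (x := s)
  rw [ModelWithCorners.range_eq_univ, mfderivWithin_univ] at h3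
  refine Eq.trans ?_ (mk_congr w' (extChartAt_to_inv (I := 𝓡 k) s))
  exact congrArg (fun q => (⟨(extChartAt (𝓡 k) s).symm (extChartAt (𝓡 k) s s), q⟩ :
    TangentBundle (𝓡 k) S)) (congrArg (fun A => A w') h3)

/-- The tangent space of a weakly-embedded leaf is the image of the derivative of its inclusion. -/
theorem mem_leafTangent_iff [IsManifold (𝓡 k) ∞ S] [IsManifold (𝓡 n) ∞ M] {F : Setoid M} {ι : S → M}
    (hι : IsWeakEmbedding k n ι) {x : M} (hr : Set.range ι = {y | F y x}) {s : S} (hs : ι s = x)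
    (v : TangentSpace (𝓡 n) x) :
    v ∈ leafTangent n F x ↔
      ∃ w : TangentSpace (𝓡 k) s, tangentMap (𝓡 k) (𝓡 n) ι ⟨s, w⟩ = ⟨x, v⟩ := by
  have hsm : ContMDiff (𝓡 k) (𝓡 n) ∞ ι := hι.isImmersion.contMDiff
  constructor
  · rintro ⟨γ, hγ, hF, hv⟩
    have hex : ∀ t, ∃ q : S, ι q = γ t := fun t => by
      have : γ t ∈ Set.range ι := by rw [hr]; exact hF t
      exact this
    choose σ hσ using hex
    let L : EuclideanSpace ℝ (Fin 1) →L[ℝ] ℝ := EuclideanSpace.proj 0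
    have h1 : ContMDiffOn (𝓡 1) (𝓡 k) ∞ (σ ∘ L) Set.univ := by
      rw [hι.plots 1 Set.univ _ isOpen_univ]
      have : ι ∘ σ ∘ L = γ ∘ L := funext fun t => hσ _
      rw [this]
      exact (hγ.comp L.contDiff.contMDiff).contMDiffOn
    let R : ℝ →L[ℝ] EuclideanSpace ℝ (Fin 1) :=
      (1 : ℝ →L[ℝ] ℝ).smulRight (EuclideanSpace.single 0 1)
    have h2 : ContMDiff 𝓘(ℝ, ℝ) (𝓡 k) ∞ σ := by
      have h3 := (contMDiffOn_univ.1 h1).comp R.contDiff.contMDiff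
      have : (σ ∘ L) ∘ R = σ := by funext t; simp [L, R]
      rwa [this] at h3
    have h4 : σ 0 = s := by
      apply hι.injective
      rw [hσ, hs]
      exact congrArg (fun q : TangentBundle (𝓡 n) M => q.1) hv
    have hcomp : ι ∘ σ = γ := funext hσ
    subst h4
    refine ⟨(tangentMap 𝓘(ℝ, ℝ) (𝓡 k) σ ⟨0, (1 : ℝ)⟩).2, ?_⟩
    rw [← hv, ← hcomp]
    exact (congrFun (tangentMap_comp (hsm.mdifferentiable (by simp))
      (h2.mdifferentiable (by simp))) ⟨0, (1 : ℝ)⟩).symm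
  · rintro ⟨w, hw⟩
    obtain ⟨σ, h1, h2⟩ := exists_curve s w
    refine ⟨ι ∘ σ, hsm.comp h1, fun t => ?_, ?_⟩
    · have : ι (σ t) ∈ Set.range ι := ⟨_, rfl⟩
      rwa [hr] at this
    · rw [← hw, ← h2]
      exact congrFun (tangentMap_comp (hsm.mdifferentiable (by simp))
        (h1.mdifferentiable (by simp))) ⟨0, (1 : ℝ)⟩

variable (n) in
/-- `L` is a connected weakly-embedded submanifold of `M`, of dimension `k`. Both the topology and the
smooth structure of `L` are those of the manifold `S`, and are finer than the subspace topology in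
general. -/
def IsConnectedWeaklyEmbedded (k : ℕ) (L : Set M) : Prop :=
  ∃ (S : Type u) (_ : TopologicalSpace S) (_ : ChartedSpace (EuclideanSpace ℝ (Fin k)) S)
    (ι : S → M), IsManifold (𝓡 k) ∞ S ∧ T2Space S ∧ SecondCountableTopology S ∧
      ConnectedSpace S ∧ IsWeakEmbedding k n ι ∧ Set.range ι = L

variable (n) in
/-- A chart `ψ : V → U × W` centred at `x`, with `U` and `W` open in `ℝᵏ` and `ℝⁿ⁻ᵏ`, which takes
each leaf `L` to a set `U × l`. -/
def HasStefanChart (k : ℕ) (F : Setoid M) (x : M) : Prop :=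
  ∃ (ψ : OpenPartialHomeomorph M (EuclideanSpace ℝ (Fin k) × EuclideanSpace ℝ (Fin (n - k))))
    (U : Set (EuclideanSpace ℝ (Fin k))) (W : Set (EuclideanSpace ℝ (Fin (n - k)))),
    ContMDiffOn (𝓡 n) 𝓘(ℝ, EuclideanSpace ℝ (Fin k) × EuclideanSpace ℝ (Fin (n - k))) ∞
      ψ ψ.source ∧
    ContMDiffOn 𝓘(ℝ, EuclideanSpace ℝ (Fin k) × EuclideanSpace ℝ (Fin (n - k))) (𝓡 n) ∞
      ψ.symm ψ.target ∧
    IsOpen U ∧ IsOpen W ∧ ψ.target = U ×ˢ W ∧ x ∈ ψ.source ∧ ψ x = (0, 0) ∧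
    ∀ y : M, ∃ l ⊆ W, ψ '' ({z | F z y} ∩ ψ.source) = U ×ˢ l

variable (n) in
/-- A (Stefan) singular foliation: a partition into connected weakly-embedded submanifolds with such a
chart about each point `x`, where `k` is the dimension of the leaf through `x`. -/
def IsSingularFoliation (F : Setoid M) : Prop :=
  ∀ x : M, ∃ k : ℕ, IsConnectedWeaklyEmbedded n k {y | F y x} ∧ HasStefanChart n k F x

variable (k n) in
/-- Surjective submersions with connected fibers. -/
structure IsConnectedFiberSubmersion (p : S → M) : Prop where
  isSubmersion : Manifold.IsSubmersion (𝓡 k) (𝓡 n) ∞ p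
  surjective : Function.Surjective p
  connected_fiber : ∀ y, IsConnected (p ⁻¹' {y})

/-- Molino transverse equivalence. The pullback `p⁻¹ F` of a partition has the leaves `p⁻¹ (L)`, that
is, it is `F.comap p`. -/
def IsMolinoEquivalent (n₀ n₁ : ℕ) {N₀ N₁ : Type u}
    [TopologicalSpace N₀] [ChartedSpace (EuclideanSpace ℝ (Fin n₀)) N₀]
    [TopologicalSpace N₁] [ChartedSpace (EuclideanSpace ℝ (Fin n₁)) N₁]
    (F₀ : Setoid N₀) (F₁ : Setoid N₁) : Prop :=
  ∃ (m : ℕ) (M : Type u) (_ : TopologicalSpace M) (_ : ChartedSpace (EuclideanSpace ℝ (Fin m)) M)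
    (F : Setoid M) (p₀ : M → N₀) (p₁ : M → N₁),
    IsManifold (𝓡 m) ∞ M ∧ T2Space M ∧ SecondCountableTopology M ∧ IsSingularFoliation m F ∧
    IsConnectedFiberSubmersion m n₀ p₀ ∧ IsConnectedFiberSubmersion m n₁ p₁ ∧
    F₀.comap p₀ = F ∧ F₁.comap p₁ = F

end
end Foliation
end

open CategoryTheory Foliation

/-!
Only the distribution `D` of values of the vector fields tangent to `F` enters the definition of a
basic form: by Cartan's formula, `α` is basic if and only if both `α` and `dα` are annihilated by
contraction with `D`. Because `p` is locally a linear projection, vector fields tangent to `p⁻¹ F`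
can be pushed forward along local sections of `p`, and vector fields tangent to `F` can be lifted
through any given tangent vector above their value; cut-off functions make both global. Hence the
distribution of `p⁻¹ F` is the preimage of `D` under the derivative of `p`, and as `p^*` commutes
with `d`, the form `p^* α` is basic exactly when `α` is.

Conversely, let `β` be basic for `p⁻¹ F`. The zero field lifts to all vertical vectors, so `β` and
`dβ` are annihilated by them, and `β` comes at each point from a form on the tangent space of `N`.
In a local product chart, the derivatives of `β` along the fibers vanish, again by Cartan's formula,
so this form on the tangent space of `N` is locally constant along the fibers, hence constant, as
the fibers are connected. It defines the form on `N` of which `β` is the pullback, smooth by means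
of local sections.
-/

local notation:max "𝔼" n:max => EuclideanSpace ℝ (Fin n)

noncomputable section

namespace Foliation

section Multilinear

variable {R ι E E' G : Type*} [CommRing R] [AddCommGroup E] [Module R E] [TopologicalSpace E]
  [AddCommGroup E'] [Module R E'] [TopologicalSpace E'] [AddCommGroup G] [Module R G]
  [TopologicalSpace G]

/-- The alternating map `f` vanishes as soon as one of its arguments lies in `K`: every contraction
of `f` with an element of `K` is zero. -/
def VanishesAlong (f : E [⋀^ι]→L[R] G) (K : Set E) : Prop :=
  ∀ v i, v i ∈ K → f v = 0

theorem VanishesAlong.mono {f : E [⋀^ι]→L[R] G} {K K' : Set E} (hf : VanishesAlong f K')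
    (hK : K ⊆ K') : VanishesAlong f K :=
  fun v i hi => hf v i (hK hi)

theorem VanishesAlong.compContinuousLinearMap {f : E' [⋀^ι]→L[R] G} {K : Set E'}
    (hf : VanishesAlong f K) (A : E →L[R] E') :
    VanishesAlong (f.compContinuousLinearMap A) (A ⁻¹' K) :=
  fun v i hi => hf (A ∘ v) i hi

theorem vanishesAlong_compContinuousLinearMap_iff {f : E' [⋀^ι]→L[R] G} {A : E →L[R] E'}
    (hA : Function.Surjective A) {K : Set E'} :
    VanishesAlong (f.compContinuousLinearMap A) (A ⁻¹' K) ↔ VanishesAlong f K := by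
  refine ⟨fun hf v i hi => ?_, fun hf => hf.compContinuousLinearMap A⟩
  obtain ⟨w, rfl⟩ := hA.comp_left v
  exact hf w i hi

theorem compContinuousLinearMap_injective {A : E →L[R] E'} (hA : Function.Surjective A) :
    Function.Injective fun f : E' [⋀^ι]→L[R] G => f.compContinuousLinearMap A := by
  intro f g hfg
  ext v
  obtain ⟨w, rfl⟩ := hA.comp_left v
  exact DFunLike.congr_fun hfg w

theorem vanishesAlong_iff_cons {k : ℕ} {f : E [⋀^Fin (k + 1)]→L[R] G} {K : Set E} :
    VanishesAlong f K ↔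
      ∀ u ∈ K, ∀ w : Fin k → E, f (Fin.cons u w : Fin (k + 1) → E) = 0 := by
  refine ⟨fun hf u hu w => hf _ 0 hu, fun hf v i hi => ?_⟩
  have hcons : f.toAlternatingMap (Matrix.vecCons (v i) (i.removeNth v)) = 0 := hf _ hi _
  have map_eq_smul := f.toAlternatingMap.map_insertNth i (v i) (i.removeNth v)
  rwa [Fin.insertNth_self_removeNth, hcons, smul_zero] at map_eq_smul

theorem VanishesAlong.map_eq [Finite ι] {f : E [⋀^ι]→L[R] G} {K : Set E} (hf : VanishesAlong f K)
    {v w : ι → E} (hvw : ∀ i, v i - w i ∈ K) : f v = f w := by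
  classical
  have := Fintype.ofFinite ι
  have map_piecewise : ∀ s : Finset ι, f (s.piecewise v w) = f w := by
    intro s
    induction s using Finset.induction_on with
    | empty => rw [Finset.piecewise_empty]
    | insert i s hi ih =>
      have hsub : f (Function.update (s.piecewise v w) i (v i - w i)) = 0 :=
        hf _ i (by simpa only [Function.update_self] using hvw i)
      rw [ContinuousAlternatingMap.map_update_sub, sub_eq_zero] at hsub
      rw [Finset.piecewise_insert, hsub, ← ih, Function.update_eq_self_iff.2]
      exact (Finset.piecewise_eq_of_notMem _ _ _ hi).symm
  simpa only [Finset.piecewise_univ] using map_piecewise Finset.univ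

theorem VanishesAlong.compContinuousLinearMap_comp [Finite ι] {f : E [⋀^ι]→L[R] G} {A : E →L[R] E'}
    (hf : VanishesAlong f (A ⁻¹' {0})) {H : E' →L[R] E} (hH : Function.RightInverse H A) :
    (f.compContinuousLinearMap H).compContinuousLinearMap A = f := by
  ext v
  refine hf.map_eq fun i => ?_
  change A (H (A (v i)) - v i) = 0
  rw [map_sub, hH, sub_self]

end Multilinear

section Alternatization

variable {𝕜 ι E E' G : Type*} [NontriviallyNormedField 𝕜] [Fintype ι]
  [NormedAddCommGroup E] [NormedSpace 𝕜 E] [NormedAddCommGroup E'] [NormedSpace 𝕜 E']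
  [NormedAddCommGroup G] [NormedSpace 𝕜 G]

section DecidableEq

variable [DecidableEq ι]

theorem continuous_alternatization : Continuous
    (ContinuousMultilinearMap.alternatization (R := 𝕜) (M := E) (N := G) (ι := ι)) := by
  rw [ContinuousAlternatingMap.isEmbedding_toContinuousMultilinearMap.continuous_iff]
  refine continuous_finsetSum _ fun σ _ => Continuous.const_smul ?_ _
  exact (ContinuousMultilinearMap.domDomCongrₗᵢ 𝕜 E G σ).continuous

variable (𝕜 ι E G) in
/-- `ContinuousMultilinearMap.alternatization` as a continuous linear map. -/
def alternatizationCLM :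
    ContinuousMultilinearMap 𝕜 (fun _ : ι => E) G →L[𝕜] E [⋀^ι]→L[𝕜] G where
  toFun := ContinuousMultilinearMap.alternatization
  map_add' := map_add _
  map_smul' c f := by
    ext v
    simp only [ContinuousMultilinearMap.alternatization_apply_apply, smul_apply,
      smul_comm _ c, ContinuousAlternatingMap.smul_apply, Finset.smul_sum,
      RingHom.id_apply]
  cont := continuous_alternatization

theorem alternatizationCLM_coe (f : E [⋀^ι]→L[𝕜] G) :
    alternatizationCLM 𝕜 ι E G f.toContinuousMultilinearMap = (Fintype.card ι).factorial • f := by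
  refine ContinuousAlternatingMap.toAlternatingMap_injective ?_
  exact (ContinuousMultilinearMap.alternatization_apply_toAlternatingMap _).trans
    (AlternatingMap.coe_alternatization f.toAlternatingMap)

end DecidableEq

-- The analogue for multilinear maps is in Mathlib; dividing the alternatization by `(card ι)!`
-- retracts them smoothly onto the alternating ones.
theorem contDiff_compContinuousLinearMap [CharZero 𝕜] {r : WithTop ℕ∞} :
    ContDiff 𝕜 r fun q : (E' [⋀^ι]→L[𝕜] G) × (E →L[𝕜] E') =>
      q.1.compContinuousLinearMap q.2 := by
  classical
  have contDiff_multilinear : ContDiff 𝕜 r fun q : (E' [⋀^ι]→L[𝕜] G) × (E →L[𝕜] E') =>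
      (q.1.compContinuousLinearMap q.2).toContinuousMultilinearMap := by
    have contDiff_pullback : ContDiff 𝕜 r fun q : (E' [⋀^ι]→L[𝕜] G) × (E →L[𝕜] E') =>
        ContinuousMultilinearMap.compContinuousLinearMapContinuousMultilinear 𝕜
          (fun _ : ι => E) (fun _ => E') G fun _ => q.2 :=
      (ContinuousMultilinearMap.contDiff _).comp (contDiff_pi.2 fun _ => contDiff_snd)
    have contDiff_coe : ContDiff 𝕜 r fun q : (E' [⋀^ι]→L[𝕜] G) × (E →L[𝕜] E') =>
        ContinuousAlternatingMap.toContinuousMultilinearMapCLM 𝕜 q.1 :=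
      (ContinuousLinearMap.contDiff _).comp contDiff_fst
    exact contDiff_pullback.clm_apply contDiff_coe
  have card_factorial_ne_zero : ((Fintype.card ι).factorial : 𝕜) ≠ 0 :=
    Nat.cast_ne_zero.2 (Nat.factorial_ne_zero _)
  convert ((alternatizationCLM 𝕜 ι E G).contDiff.comp contDiff_multilinear).const_smul
    ((Fintype.card ι).factorial : 𝕜)⁻¹ using 2 with q
  rw [Function.comp_apply, alternatizationCLM_coe, ← Nat.cast_smul_eq_nsmul 𝕜,
    inv_smul_smul₀ card_factorial_ne_zero]

end Alternatization

section FDeriv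

variable {E G : Type*} [NormedAddCommGroup E] [NormedSpace ℝ E] [NormedAddCommGroup G]
  [NormedSpace ℝ G]

-- This is `L_w a = d (ι_w a) + ι_w (d a)` for a constant vector field `w`.
theorem fderiv_apply_eq_zero_of_vanishesAlong {k : ℕ} {a : E → E [⋀^Fin k]→L[ℝ] ℝ} {z w : E}
    (ha : DifferentiableAt ℝ a z) (ha₀ : ∀ᶠ z' in 𝓝 z, VanishesAlong (a z') {w})
    (ha₁ : VanishesAlong (extDeriv a z) {w}) : fderiv ℝ a z w = 0 := by
  ext v
  have cartan : extDeriv a z (Fin.cons w v : Fin (k + 1) → E) = modelLie (fun _ => w) a z v := by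
    cases k with
    | zero => exact modelLie_zero_form (X := fun _ => w) v
    | succ k =>
      refine modelLie_eq (X := fun _ => w) (differentiableAt_const _) ha ?_ v
      filter_upwards [ha₀] with z' hz' u using hz' _ 0 rfl
  have lie_eq_zero := cartan.symm.trans (ha₁ _ 0 rfl)
  simpa only [modelLie, fderiv_fun_const, Pi.zero_apply, zero_apply,
    ContinuousAlternatingMap.map_update_zero, Finset.sum_const_zero, add_zero,
    ContinuousAlternatingMap.coe_zero] using lie_eq_zero

theorem eq_of_fderiv_apply_sub_eq_zero {s : Set E} (hs : Convex ℝ s) {f : E → G}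
    (hf : ∀ y ∈ s, DifferentiableAt ℝ f y) {z z' : E} (hz : z ∈ s) (hz' : z' ∈ s)
    (hf' : ∀ y ∈ s, fderiv ℝ f y (z' - z) = 0) : f z' = f z := by
  have segment_mem : ∀ t ∈ Set.Icc (0 : ℝ) 1, z + t • (z' - z) ∈ s := fun t ht =>
    hs.add_smul_sub_mem hz hz' ht
  have hasDerivAt_segment : ∀ t ∈ Set.Icc (0 : ℝ) 1,
      HasDerivAt (fun t : ℝ => f (z + t • (z' - z))) 0 t := by
    intro t ht
    have hasDerivAt_line : HasDerivAt (fun t : ℝ => z + t • (z' - z)) (z' - z) t := by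
      simpa only [one_smul, id_eq] using
        ((hasDerivAt_id t).smul_const (z' - z)).const_add z
    rw [← hf' _ (segment_mem t ht)]
    exact (hf _ (segment_mem t ht)).hasFDerivAt.comp_hasDerivAt t hasDerivAt_line
  have eq_at_one := constant_of_has_deriv_right_zero
    (fun t ht => (hasDerivAt_segment t ht).continuousAt.continuousWithinAt)
    (fun t ht => (hasDerivAt_segment t ⟨ht.1, ht.2.le⟩).hasDerivWithinAt) 1 ⟨zero_le_one, le_rfl⟩
  simpa only [one_smul, zero_smul, add_zero, add_sub_cancel] using eq_at_one

end FDeriv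

section PullModel

variable {n : ℕ} {M : Type u} [TopologicalSpace M] [ChartedSpace 𝔼 n M]
  {V : Type*} [NormedAddCommGroup V] [NormedSpace ℝ V] {k : ℕ}

/-- The pullback of a form on a manifold along a map `g` out of a normed space, as an honest
function on that space; for `g` the inverse of a preferred chart this is `chartRep`. -/
def pullModel (α : RawForm n M k) (g : V → M) (y : V) : V [⋀^Fin k]→L[ℝ] ℝ :=
  (α (g y)).compContinuousLinearMap (mfderiv 𝓘(ℝ, V) (𝓡 n) g y)

theorem form_congr (α : RawForm n M k) {a b : M} (hab : a = b) {v w : Fin k → 𝔼 n} (hvw : v = w) :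
    α a v = α b w := by
  subst hab hvw
  rfl

theorem pullModel_congr (α : RawForm n M k) {g g' : V → M} {y : V} (h : g =ᶠ[𝓝 y] g') :
    pullModel α g y = pullModel α g' y := by
  ext v
  exact form_congr α h.eq_of_nhds
    (funext fun i => congr_arg (fun A : V →L[ℝ] 𝔼 n => A (v i)) h.mfderiv_eq)

theorem isSmoothForm_iff_contDiffAt {α : RawForm n M k} : IsSmoothForm α ↔
    ∀ c : M, ∀ y ∈ (extChartAt (𝓡 n) c).target, ContDiffAt ℝ ∞ (chartRep α c) y :=
  forall_congr' fun c => ⟨fun h _ hy => h.contDiffAt ((isOpen_extChartAt_target c).mem_nhds hy),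
    fun h _ hy => (h _ hy).contDiffWithinAt⟩

theorem contDiffAt_extChartAt_comp {g : V → M} {y : V}
    (hg : ContMDiffAt 𝓘(ℝ, V) (𝓡 n) ∞ g y) :
    ContDiffAt ℝ ∞ (fun z => extChartAt (𝓡 n) (g y) (g z)) y :=
  contMDiffAt_iff_contDiffAt.1 (contMDiffAt_extChartAt.comp y hg)

variable [IsManifold (𝓡 n) ∞ M]

theorem contMDiffAt_extChartAt_symm {c : M} {y : 𝔼 n} (hy : y ∈ (extChartAt (𝓡 n) c).target) :
    ContMDiffAt 𝓘(ℝ, 𝔼 n) (𝓡 n) ∞ (extChartAt (𝓡 n) c).symm y :=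
  (contMDiffOn_extChartAt_symm c).contMDiffAt ((isOpen_extChartAt_target c).mem_nhds hy)

theorem pullModel_eventuallyEq (α : RawForm n M k) {g : V → M} {y : V}
    (hg : ∀ᶠ z in 𝓝 y, ContMDiffAt 𝓘(ℝ, V) (𝓡 n) ∞ g z) :
    pullModel α g =ᶠ[𝓝 y] fun z =>
      (chartRep α (g y) (extChartAt (𝓡 n) (g y) (g z))).compContinuousLinearMap
        (fderiv ℝ (fun z' => extChartAt (𝓡 n) (g y) (g z')) z) := by
  have mem_source : ∀ᶠ z in 𝓝 y, g z ∈ (extChartAt (𝓡 n) (g y)).source :=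
    hg.self_of_nhds.continuousAt.eventually_mem (extChartAt_source_mem_nhds (g y))
  filter_upwards [hg, mem_source.eventually_nhds] with z hgz hsz
  have mdiff_chart_comp : MDifferentiableAt 𝓘(ℝ, V) 𝓘(ℝ, 𝔼 n)
      (fun z' => extChartAt (𝓡 n) (g y) (g z')) z :=
    ((contMDiffAt_extChartAt' (by simpa only [extChartAt_source] using hsz.self_of_nhds)).comp z
      hgz).mdifferentiableAt (by simp)
  have mfderiv_eq := mfderiv_comp z ((contMDiffAt_extChartAt_symm
    ((extChartAt (𝓡 n) (g y)).map_source hsz.self_of_nhds)).mdifferentiableAt (by simp))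
    mdiff_chart_comp
  rw [mfderiv_eq_fderiv] at mfderiv_eq
  have eq_symm_comp : g =ᶠ[𝓝 z]
      (extChartAt (𝓡 n) (g y)).symm ∘ fun z' => extChartAt (𝓡 n) (g y) (g z') := by
    filter_upwards [hsz] with z' hz'
    exact ((extChartAt (𝓡 n) (g y)).left_inv hz').symm
  rw [pullModel_congr α eq_symm_comp, pullModel, mfderiv_eq]
  rfl

variable {α : RawForm n M k} {g : V → M} {y : V}

theorem contDiffAt_pullModel (hα : IsSmoothForm α)
    (hg : ∀ᶠ z in 𝓝 y, ContMDiffAt 𝓘(ℝ, V) (𝓡 n) ∞ g z) :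
    ContDiffAt ℝ ∞ (pullModel α g) y := by
  refine ContDiffAt.congr_of_eventuallyEq ?_ (pullModel_eventuallyEq α hg)
  have contDiffAt_chart_comp := contDiffAt_extChartAt_comp hg.self_of_nhds
  have contDiffAt_chartRep : ContDiffAt ℝ ∞ (chartRep α (g y)) (extChartAt (𝓡 n) (g y) (g y)) :=
    (hα _).contDiffAt (extChartAt_target_mem_nhds (g y))
  exact contDiff_compContinuousLinearMap.contDiffAt.comp y
    ((contDiffAt_chartRep.comp y contDiffAt_chart_comp).prodMk
      (contDiffAt_chart_comp.fderiv_right (by simp)))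

theorem extDeriv_pullModel (hα : IsSmoothForm α)
    (hg : ∀ᶠ z in 𝓝 y, ContMDiffAt 𝓘(ℝ, V) (𝓡 n) ∞ g z) :
    extDeriv (pullModel α g) y = pullModel (rawD α) g y := by
  rw [(pullModel_eventuallyEq α hg).extDeriv_eq, (pullModel_eventuallyEq (rawD α) hg).eq_of_nhds,
    chartRep_rawD hα _ (mem_extChartAt_target _)]
  exact extDeriv_pullback (hα.differentiableAt _ (mem_extChartAt_target _))
    (contDiffAt_extChartAt_comp hg.self_of_nhds)
    (by simpa using WithTop.coe_le_coe.2 (le_top : (2 : ℕ∞) ≤ ⊤))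

end PullModel

section PullbackForm

variable {m n : ℕ} {M N : Type u} [TopologicalSpace M] [ChartedSpace 𝔼 m M]
  [TopologicalSpace N] [ChartedSpace 𝔼 n N] {k : ℕ} {α : RawForm n N k} {p : M → N}

theorem pullModel_pullbackForm {V : Type*} [NormedAddCommGroup V] [NormedSpace ℝ V] {g : V → M}
    {y : V} (hp : MDifferentiableAt (𝓡 m) (𝓡 n) p (g y))
    (hg : MDifferentiableAt 𝓘(ℝ, V) (𝓡 m) g y) :
    pullModel (pullbackForm p α : RawForm m M k) g y = pullModel α (p ∘ g) y := by
  rw [pullModel, pullModel, mfderiv_comp y hp hg]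
  rfl

variable [IsManifold (𝓡 m) ∞ M]

theorem chartRep_pullbackForm_eventuallyEq (hp : ContMDiff (𝓡 m) (𝓡 n) ∞ p) {c : M} {y : 𝔼 m}
    (hy : y ∈ (extChartAt (𝓡 m) c).target) :
    chartRep (pullbackForm p α : RawForm m M k) c =ᶠ[𝓝 y]
      pullModel α (p ∘ (extChartAt (𝓡 m) c).symm) := by
  filter_upwards [(isOpen_extChartAt_target c).mem_nhds hy] with z hz
  exact pullModel_pullbackForm (hp.mdifferentiable (by simp) _)
    ((contMDiffAt_extChartAt_symm hz).mdifferentiableAt (by simp))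

theorem eventually_contMDiffAt_comp_extChartAt_symm (hp : ContMDiff (𝓡 m) (𝓡 n) ∞ p) {c : M}
    {y : 𝔼 m} (hy : y ∈ (extChartAt (𝓡 m) c).target) :
    ∀ᶠ z in 𝓝 y, ContMDiffAt 𝓘(ℝ, 𝔼 m) (𝓡 n) ∞ (p ∘ (extChartAt (𝓡 m) c).symm) z := by
  filter_upwards [(isOpen_extChartAt_target c).mem_nhds hy] with z hz
  exact (hp _).comp z (contMDiffAt_extChartAt_symm hz)

variable [IsManifold (𝓡 n) ∞ N]

theorem IsSmoothForm.pullbackForm (hα : IsSmoothForm α) (hp : ContMDiff (𝓡 m) (𝓡 n) ∞ p) :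
    IsSmoothForm (Foliation.pullbackForm p α : RawForm m M k) :=
  isSmoothForm_iff_contDiffAt.2 fun _ _ hy => (contDiffAt_pullModel hα
    (eventually_contMDiffAt_comp_extChartAt_symm hp hy)).congr_of_eventuallyEq
    (chartRep_pullbackForm_eventuallyEq hp hy)

theorem rawD_pullbackForm (hα : IsSmoothForm α) (hp : ContMDiff (𝓡 m) (𝓡 n) ∞ p) :
    rawD (pullbackForm p α : RawForm m M k) = pullbackForm p (rawD α) := by
  funext x
  have hx := mem_extChartAt_target (I := 𝓡 m) x
  have extDeriv_eq : extDeriv (chartRep (pullbackForm p α : RawForm m M k) x)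
      (extChartAt (𝓡 m) x x) =
        chartRep (pullbackForm p (rawD α) : RawForm m M (k + 1)) x (extChartAt (𝓡 m) x x) := by
    rw [(chartRep_pullbackForm_eventuallyEq hp hx).extDeriv_eq,
      (chartRep_pullbackForm_eventuallyEq hp hx).eq_of_nhds]
    exact extDeriv_pullModel hα (eventually_contMDiffAt_comp_extChartAt_symm hp hx)
  have mfderiv_symm_eq_id := mfderivWithin_range_extChartAt_symm (I := 𝓡 m) (x := x)
  rw [ModelWithCorners.range_eq_univ, mfderivWithin_univ] at mfderiv_symm_eq_id
  have mfderiv_symm_comp_apply : ∀ w : 𝔼 m,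
      mfderiv 𝓘(ℝ, 𝔼 m) (𝓡 m) (extChartAt (𝓡 m) x).symm (extChartAt (𝓡 m) x x)
        (mfderiv (𝓡 m) 𝓘(ℝ, 𝔼 m) (extChartAt (𝓡 m) x) x w) = w := fun w => by
    rw [mfderiv_extChartAt_self]
    exact DFunLike.congr_fun mfderiv_symm_eq_id w
  rw [rawD, extDeriv_eq]
  ext v
  exact form_congr (pullbackForm p (rawD α)) (extChartAt_to_inv x)
    (funext fun i => mfderiv_symm_comp_apply (v i))

end PullbackForm

section LeafTangent

variable {n : ℕ} {M : Type u} [TopologicalSpace M] [ChartedSpace 𝔼 n M] {F : Setoid M} {x : M}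

theorem velocity_eq_iff {V : Type*} [NormedAddCommGroup V] [NormedSpace ℝ V] {γ : ℝ → V} {t : ℝ}
    {a b : V} : tangentMap 𝓘(ℝ, ℝ) 𝓘(ℝ, V) γ ⟨t, (1 : ℝ)⟩ = ⟨a, b⟩ ↔ γ t = a ∧ deriv γ t = b := by
  have mfderiv_apply_one : mfderiv 𝓘(ℝ, ℝ) 𝓘(ℝ, V) γ t (1 : ℝ) = deriv γ t :=
    congr_arg (fun A : ℝ →L[ℝ] V => A 1) mfderiv_eq_fderiv
  constructor
  · exact fun h => ⟨congr_arg (fun q : TangentBundle 𝓘(ℝ, V) V => q.proj) h,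
      mfderiv_apply_one.symm.trans (congr_arg (fun q : TangentBundle 𝓘(ℝ, V) V => (q.2 : V)) h)⟩
  · rintro ⟨rfl, rfl⟩
    exact congr_arg (fun u => (⟨γ t, u⟩ : TangentBundle 𝓘(ℝ, V) V)) mfderiv_apply_one

theorem mem_leafTangent_of_local {γ : ℝ → M} {O : Set ℝ} (hO : IsOpen O) (h0 : (0 : ℝ) ∈ O)
    (hγ : ContMDiffOn 𝓘(ℝ, ℝ) (𝓡 n) ∞ γ O) (hF : ∀ t ∈ O, F (γ t) x)
    {v : TangentSpace (𝓡 n) x} (hv : tangentMap 𝓘(ℝ, ℝ) (𝓡 n) γ ⟨0, (1 : ℝ)⟩ = ⟨x, v⟩) :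
    v ∈ leafTangent n F x := by
  obtain ⟨f, hf, hfO, hf0, hf'⟩ := exists_model_curve hO h0 (1 : ℝ)
  have contMDiffAt_γ : ∀ t ∈ O, ContMDiffAt 𝓘(ℝ, ℝ) (𝓡 n) ∞ γ t :=
    fun t ht => hγ.contMDiffAt (hO.mem_nhds ht)
  refine ⟨γ ∘ f, fun t => (contMDiffAt_γ _ (hfO t)).comp t hf.contMDiff.contMDiffAt,
    fun t => hF _ (hfO t), ?_⟩
  rw [tangentMap_comp_at _ ((contMDiffAt_γ _ (hfO 0)).mdifferentiableAt (by simp))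
    (hf.contMDiff.mdifferentiableAt (by simp)), velocity_eq_iff.2 ⟨hf0, hf'.deriv⟩, hv]

theorem smul_mem_leafTangent {v : TangentSpace (𝓡 n) x} (hv : v ∈ leafTangent n F x) (c : ℝ) :
    c • v ∈ leafTangent n F x := by
  obtain ⟨γ, hγ, hF, hv⟩ := hv
  cases hv
  have contDiff_mul : ContDiff ℝ ∞ fun t : ℝ => c * t := contDiff_const.mul contDiff_id
  refine ⟨γ ∘ fun t => c * t, hγ.comp contDiff_mul.contMDiff, fun t => hF _, ?_⟩
  rw [tangentMap_comp_at _ (hγ.mdifferentiableAt (by simp))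
    (contDiff_mul.contMDiff.mdifferentiableAt (by simp)),
    (velocity_eq_iff (b := c)).2 ⟨mul_zero c, by simp⟩]
  have map_eq_smul : mfderiv 𝓘(ℝ, ℝ) (𝓡 n) γ 0 c = c • mfderiv 𝓘(ℝ, ℝ) (𝓡 n) γ 0 (1 : ℝ) :=
    (congr_arg (mfderiv 𝓘(ℝ, ℝ) (𝓡 n) γ 0 : ℝ →L[ℝ] 𝔼 n) (mul_one c).symm).trans
      ((mfderiv 𝓘(ℝ, ℝ) (𝓡 n) γ 0 : ℝ →L[ℝ] 𝔼 n).map_smul c 1)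
  exact congr_arg (Bundle.TotalSpace.mk (γ 0)) map_eq_smul

theorem zero_mem_leafTangent : (0 : TangentSpace (𝓡 n) x) ∈ leafTangent n F x := by
  refine ⟨fun _ => x, contMDiff_const, fun _ => F.refl x, ?_⟩
  rw [tangentMap, mfderiv_const]
  rfl

variable [IsManifold (𝓡 n) ∞ M]

variable (n F) in
/-- The values at `x` of the smooth vector fields tangent to `F`. For a singular foliation this is
the tangent space of the leaf; for an arbitrary partition it may be smaller than `leafTangent`, and
it is this set which decides whether a form is basic. -/
def tangentDistribution (x : M) : Set (TangentSpace (𝓡 n) x) :=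
  {v | ∃ X : VField n M, IsTangentField F X ∧ X x = v}

theorem mem_tangentDistribution_of_local [T2Space M] {A : Set M} (hA : IsOpen A) (hx : x ∈ A)
    {σ : M → TangentBundle (𝓡 n) M} (hσ : ContMDiffOn (𝓡 n) (𝓡 n).tangent ∞ σ A)
    (hσA : ∀ y ∈ A, (σ y).proj = y) (hσF : ∀ y ∈ A, (σ y).2 ∈ leafTangent n F (σ y).proj)
    {v : TangentSpace (𝓡 n) x} (hv : σ x = ⟨x, v⟩) : v ∈ tangentDistribution n F x := by
  let X : VField n M := fun y => ((σ y).2 : 𝔼 n)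
  have mk_X : ∀ y ∈ A, (⟨y, X y⟩ : TangentBundle (𝓡 n) M) = σ y :=
    fun y hy => mk_congr (X y) (hσA y hy).symm
  have X_mem : ∀ y ∈ A, X y ∈ leafTangent n F y := fun y hy => by
    have hy' := hσF y hy
    rwa [← mk_X y hy] at hy'
  obtain ⟨χ, hχ, -⟩ := (SmoothBumpFunction.nhds_basis_support (I := 𝓡 n)
    (hA.mem_nhds hx)).mem_iff.1 (hA.mem_nhds hx)
  refine ⟨fun y => χ y • X y, ⟨?_, fun y => ?_⟩, ?_⟩
  · exact ContMDiffOn.smul_section_of_tsupport χ.contMDiff.contMDiffOn hA hχ (hσ.congr mk_X)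
  · by_cases hy : y ∈ A
    · exact smul_mem_leafTangent (X_mem y hy) (χ y)
    · have χ_eq_zero : χ y = 0 := image_eq_zero_of_notMem_tsupport fun hy' => hy (hχ hy')
      change χ y • X y ∈ leafTangent n F y
      rw [χ_eq_zero, zero_smul]
      exact zero_mem_leafTangent
  · change χ x • X x = v
    rw [χ.eq_one, one_smul]
    exact congr_arg (fun q : TangentBundle (𝓡 n) M => (q.2 : 𝔼 n)) hv

theorem zero_mem_tangentDistribution : (0 : TangentSpace (𝓡 n) x) ∈ tangentDistribution n F x :=
  ⟨0, ⟨Bundle.contMDiff_zeroSection ℝ _, fun _ => zero_mem_leafTangent⟩, rfl⟩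

end LeafTangent

section TangentMap

variable {m n : ℕ} {M N : Type*} [TopologicalSpace M] [ChartedSpace 𝔼 m M]
  [TopologicalSpace N] [ChartedSpace 𝔼 n N]

theorem tangentMap_symm_tangentMap {e : OpenPartialHomeomorph M N}
    (he : e.MDifferentiable (𝓡 m) (𝓡 n)) {q : TangentBundle (𝓡 m) M} (hq : q.proj ∈ e.source) :
    tangentMap (𝓡 n) (𝓡 m) e.symm (tangentMap (𝓡 m) (𝓡 n) e q) = q :=
  (congr_arg (Bundle.TotalSpace.mk (e.symm (e q.proj)))
    (congr_arg (fun A : 𝔼 m →L[ℝ] 𝔼 m => A q.2) (he.symm_comp_deriv hq))).trans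
    (mk_congr q.2 (e.left_inv hq))

theorem tangentMap_injOn {e : OpenPartialHomeomorph M N} (he : e.MDifferentiable (𝓡 m) (𝓡 n)) :
    Set.InjOn (tangentMap (𝓡 m) (𝓡 n) e) (Bundle.TotalSpace.proj ⁻¹' e.source) :=
  Set.LeftInvOn.injOn fun _ hq => tangentMap_symm_tangentMap he hq

theorem tangentMap_continuousLinearMap (A : 𝔼 m →L[ℝ] 𝔼 n) (z w : 𝔼 m) :
    tangentMap (𝓡 m) (𝓡 n) A ⟨z, w⟩ = ⟨A z, A w⟩ :=
  congr_arg (fun B : 𝔼 m →L[ℝ] 𝔼 n => (⟨A z, B w⟩ : TangentBundle (𝓡 n) (𝔼 n)))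
    A.mfderiv_eq

theorem mdifferentiable_of_mem_maximalAtlas {e : OpenPartialHomeomorph M (𝔼 m)}
    (he : e ∈ IsManifold.maximalAtlas (𝓡 m) ∞ M) :
    e.MDifferentiable (𝓡 m) (𝓡 m) :=
  ⟨(contMDiffOn_of_mem_maximalAtlas he).mdifferentiableOn (by simp),
    (contMDiffOn_symm_of_mem_maximalAtlas he).mdifferentiableOn (by simp)⟩

variable [IsManifold (𝓡 m) ∞ M] [IsManifold (𝓡 n) ∞ N]

theorem contMDiffOn_tangentMap {f : M → N} {s : Set M} (hf : ContMDiffOn (𝓡 m) (𝓡 n) ∞ f s)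
    (hs : IsOpen s) : ContMDiffOn (𝓡 m).tangent (𝓡 n).tangent ∞ (tangentMap (𝓡 m) (𝓡 n) f)
      (Bundle.TotalSpace.proj ⁻¹' s) := by
  refine (hf.contMDiffOn_tangentMapWithin (m := ∞) (by simp) hs.uniqueMDiffOn).congr
    fun q hq => ?_
  exact (tangentMapWithin_eq_tangentMap (hs.uniqueMDiffOn _ hq)
    ((hf.contMDiffAt (hs.mem_nhds hq)).mdifferentiableAt (by simp))).symm

end TangentMap

section FiberedChart

variable {m n : ℕ} {M N : Type u} [TopologicalSpace M] [ChartedSpace 𝔼 m M]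
  [TopologicalSpace N] [ChartedSpace 𝔼 n N] {p : M → N} {x : M}

variable (m n) in
/-- Charts about `x` and `p x` in which `p` is a linear projection `π`, with a linear section
`j`: the local normal form of a submersion. -/
structure FiberedChart (p : M → N) (x : M) where
  φ : OpenPartialHomeomorph M (𝔼 m)
  ψ : OpenPartialHomeomorph N (𝔼 n)
  π : 𝔼 m →L[ℝ] 𝔼 n
  j : 𝔼 n →L[ℝ] 𝔼 m
  φ_mem_maximalAtlas : φ ∈ IsManifold.maximalAtlas (𝓡 m) ∞ M
  ψ_mem_maximalAtlas : ψ ∈ IsManifold.maximalAtlas (𝓡 n) ∞ N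
  mem_source : x ∈ φ.source
  mapsTo : Set.MapsTo p φ.source ψ.source
  apply_eq : ∀ y ∈ φ.source, ψ (p y) = π (φ y)
  π_j : ∀ a, π (j a) = a

theorem nonempty_fiberedChart (hp : Manifold.IsSubmersion (𝓡 m) (𝓡 n) ∞ p) (x : M) :
    Nonempty (FiberedChart m n p x) := by
  have hpx := hp.isSubmersionAt x
  exact ⟨{
    φ := hpx.domChart
    ψ := hpx.codChart
    π := (ContinuousLinearMap.fst ℝ _ hpx.complement).comp hpx.equiv.toContinuousLinearMap
    j := hpx.equiv.symm.toContinuousLinearMap.comp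
      (ContinuousLinearMap.inl ℝ _ hpx.complement)
    φ_mem_maximalAtlas := hpx.domChart_mem_maximalAtlas
    ψ_mem_maximalAtlas := hpx.codChart_mem_maximalAtlas
    mem_source := hpx.mem_domChart_source
    mapsTo := hpx.source_subset_preimage_source
    apply_eq := fun y hy => by
      have mem_target : hpx.domChart y ∈ (hpx.domChart.extend (𝓡 m)).target := by
        simpa using hpx.domChart.map_source hy
      simpa [hpx.domChart.left_inv hy] using hpx.writtenInCharts mem_target
    π_j := fun a => by simp }⟩

namespace FiberedChart

variable (C : FiberedChart m n p x)

/-- Among the vectors with image `a` under `π`, the one which differs from `u` by an element of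
the range of `j`. -/
def adjust : 𝔼 n × 𝔼 m →L[ℝ] 𝔼 m :=
  ContinuousLinearMap.snd ℝ _ _ +
    C.j.comp (ContinuousLinearMap.fst ℝ _ _ - C.π.comp (ContinuousLinearMap.snd ℝ _ _))

theorem π_adjust (a : 𝔼 n) (u : 𝔼 m) : C.π (C.adjust (a, u)) = a := by
  simp [adjust, C.π_j]

theorem adjust_π (u : 𝔼 m) : C.adjust (C.π u, u) = u := by
  simp [adjust]

include C in
theorem mem_source_right : p x ∈ C.ψ.source :=
  C.mapsTo C.mem_source

theorem apply_symm {z : 𝔼 m} (hz : z ∈ C.φ.target) : p (C.φ.symm z) = C.ψ.symm (C.π z) := by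
  rw [← C.φ.right_inv hz, ← C.apply_eq _ (C.φ.map_target hz), C.φ.right_inv hz,
    C.ψ.left_inv (C.mapsTo (C.φ.map_target hz))]

theorem apply_symm_adjust {y : N} {u : 𝔼 m} (hy : y ∈ C.ψ.source)
    (hu : C.adjust (C.ψ y, u) ∈ C.φ.target) : p (C.φ.symm (C.adjust (C.ψ y, u))) = y := by
  rw [C.apply_symm hu, C.π_adjust, C.ψ.left_inv hy]

theorem mdifferentiable_φ : C.φ.MDifferentiable (𝓡 m) (𝓡 m) :=
  mdifferentiable_of_mem_maximalAtlas C.φ_mem_maximalAtlas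

theorem contMDiffOn_adjust {P : Type*} [TopologicalSpace P] {H E : Type*}
    [NormedAddCommGroup E] [NormedSpace ℝ E] [TopologicalSpace H] [ChartedSpace H P]
    {I : ModelWithCorners ℝ E H} {f : P → 𝔼 n} {g : P → 𝔼 m} {s : Set P}
    (hf : ContMDiffOn I (𝓡 n) ∞ f s) (hg : ContMDiffOn I (𝓡 m) ∞ g s) :
    ContMDiffOn I (𝓡 m) ∞ (fun t => C.adjust (f t, g t)) s :=
  C.adjust.contMDiff.comp_contMDiffOn (hf.prodMk_space hg)

theorem contMDiffOn_φ_symm : ContMDiffOn (𝓡 m) (𝓡 m) ∞ C.φ.symm C.φ.target :=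
  contMDiffOn_symm_of_mem_maximalAtlas C.φ_mem_maximalAtlas

theorem contMDiffOn_ψ : ContMDiffOn (𝓡 n) (𝓡 n) ∞ C.ψ C.ψ.source :=
  contMDiffOn_of_mem_maximalAtlas C.ψ_mem_maximalAtlas

theorem mdifferentiable_ψ : C.ψ.MDifferentiable (𝓡 n) (𝓡 n) :=
  mdifferentiable_of_mem_maximalAtlas C.ψ_mem_maximalAtlas

theorem tangentMap_tangentMap {q : TangentBundle (𝓡 m) M}
    (hp : MDifferentiableAt (𝓡 m) (𝓡 n) p q.proj)
    (hq : q.proj ∈ C.φ.source) :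
    tangentMap (𝓡 n) (𝓡 n) C.ψ (tangentMap (𝓡 m) (𝓡 n) p q) =
      tangentMap (𝓡 m) (𝓡 n) C.π (tangentMap (𝓡 m) (𝓡 m) C.φ q) := by
  have comp_eq : C.ψ ∘ p =ᶠ[𝓝 q.proj] C.π ∘ C.φ := by
    filter_upwards [C.φ.open_source.mem_nhds hq] with y hy using C.apply_eq y hy
  rw [← tangentMap_comp_at q (C.mdifferentiable_ψ.mdifferentiableAt (C.mapsTo hq)) hp,
    ← tangentMap_comp_at q (C.π.mdifferentiableAt (x := C.φ q.proj))
      (C.mdifferentiable_φ.mdifferentiableAt hq)]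
  refine (mk_congr _ comp_eq.eq_of_nhds).trans ?_
  exact congr_arg (fun A : 𝔼 m →L[ℝ] 𝔼 n =>
    (⟨C.π (C.φ q.proj), A q.2⟩ : TangentBundle (𝓡 n) (𝔼 n))) comp_eq.mfderiv_eq

theorem velocity_adjust (hp : MDifferentiableAt (𝓡 m) (𝓡 n) p x) {δ : ℝ → N}
    (hδ : MDifferentiableAt 𝓘(ℝ, ℝ) (𝓡 n) δ 0) {v : TangentSpace (𝓡 m) x}
    (hδv : tangentMap 𝓘(ℝ, ℝ) (𝓡 n) δ ⟨0, (1 : ℝ)⟩ = tangentMap (𝓡 m) (𝓡 n) p ⟨x, v⟩)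
    {u : 𝔼 m} (hu : mfderiv (𝓡 m) (𝓡 m) C.φ x v = u) :
    tangentMap 𝓘(ℝ, ℝ) (𝓡 m) (fun t => C.adjust (C.ψ (δ t), C.φ x + t • u)) ⟨0, (1 : ℝ)⟩ =
      tangentMap (𝓡 m) (𝓡 m) C.φ ⟨x, v⟩ := by
  have tangentMap_φ : tangentMap (𝓡 m) (𝓡 m) C.φ ⟨x, v⟩ = ⟨C.φ x, u⟩ :=
    congr_arg (Bundle.TotalSpace.mk (C.φ x)) hu
  have δ_zero : δ 0 = p x := congr_arg (fun q : TangentBundle (𝓡 n) N => q.proj) hδv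
  have mdifferentiableAt_ψ : MDifferentiableAt (𝓡 n) (𝓡 n) C.ψ (δ 0) :=
    C.mdifferentiable_ψ.mdifferentiableAt (δ_zero ▸ C.mapsTo C.mem_source)
  have velocity_ψδ : tangentMap 𝓘(ℝ, ℝ) (𝓡 n) (C.ψ ∘ δ) ⟨0, (1 : ℝ)⟩ =
      ⟨C.π (C.φ x), C.π u⟩ := by
    rw [tangentMap_comp_at _ mdifferentiableAt_ψ hδ, hδv,
      C.tangentMap_tangentMap hp C.mem_source, tangentMap_φ]
    exact tangentMap_continuousLinearMap _ _ _
  obtain ⟨ψδ_zero, deriv_ψδ⟩ := velocity_eq_iff.1 velocity_ψδ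
  have hasDerivAt_ψδ : HasDerivAt (C.ψ ∘ δ) (C.π u) 0 :=
    deriv_ψδ ▸ (mdifferentiableAt_ψ.comp 0 hδ).differentiableAt.hasDerivAt
  have hasDerivAt_line : HasDerivAt (fun t : ℝ => C.φ x + t • u) u 0 := by
    simpa only [one_smul, id_eq] using ((hasDerivAt_id (0 : ℝ)).smul_const u).const_add (C.φ x)
  have hasDerivAt_adjust :=
    C.adjust.hasFDerivAt.comp_hasDerivAt 0 (hasDerivAt_ψδ.prodMk hasDerivAt_line)
  refine (velocity_eq_iff.2 ⟨?_, hasDerivAt_adjust.deriv.trans (C.adjust_π u)⟩).trans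
    tangentMap_φ.symm
  calc C.adjust ((C.ψ ∘ δ) 0, C.φ x + (0 : ℝ) • u) = C.adjust (C.π (C.φ x), C.φ x) := by
        rw [ψδ_zero, zero_smul, add_zero]
    _ = C.φ x := C.adjust_π _

end FiberedChart

theorem exists_local_section (hp : Manifold.IsSubmersion (𝓡 m) (𝓡 n) ∞ p) (x : M) :
    ∃ (B : Set N) (s : N → M), IsOpen B ∧ p x ∈ B ∧ ContMDiffOn (𝓡 n) (𝓡 m) ∞ s B ∧
      s (p x) = x ∧ ∀ y ∈ B, p (s y) = y := by
  obtain ⟨C⟩ := nonempty_fiberedChart hp x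
  let c : N → 𝔼 m := fun y => C.adjust (C.ψ y, C.φ x)
  have c_apply : c (p x) = C.φ x := by
    change C.adjust (C.ψ (p x), C.φ x) = C.φ x
    rw [C.apply_eq x C.mem_source, C.adjust_π]
  have contMDiffOn_c : ContMDiffOn (𝓡 n) (𝓡 m) ∞ c C.ψ.source :=
    C.contMDiffOn_adjust C.contMDiffOn_ψ contMDiffOn_const
  refine ⟨C.ψ.source ∩ c ⁻¹' C.φ.target, C.φ.symm ∘ c,
    contMDiffOn_c.continuousOn.isOpen_inter_preimage C.ψ.open_source C.φ.open_target,
    ⟨C.mem_source_right, ?_⟩, C.contMDiffOn_φ_symm.comp' contMDiffOn_c, ?_,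
    fun y hy => C.apply_symm_adjust hy.1 hy.2⟩
  · exact Set.mem_preimage.2 (c_apply ▸ C.φ.map_source C.mem_source)
  · rw [Function.comp_apply, c_apply, C.φ.left_inv C.mem_source]

variable {F : Setoid N}

theorem mfderiv_mem_leafTangent (hp : ContMDiff (𝓡 m) (𝓡 n) ∞ p) {v : TangentSpace (𝓡 m) x}
    (hv : v ∈ leafTangent m (F.comap p) x) :
    mfderiv (𝓡 m) (𝓡 n) p x v ∈ leafTangent n F (p x) := by
  obtain ⟨γ, hγ, hγF, hγv⟩ := hv
  refine ⟨p ∘ γ, hp.comp hγ, hγF, ?_⟩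
  rw [tangentMap_comp_at _ (hp.mdifferentiableAt (by simp)) (hγ.mdifferentiableAt (by simp)), hγv]
  rfl

-- A curve `δ` in the leaf of `p x` is lifted through the fibered chart, along the straight line
-- with the prescribed initial velocity.
theorem mem_leafTangent_comap_iff (hp : Manifold.IsSubmersion (𝓡 m) (𝓡 n) ∞ p)
    {v : TangentSpace (𝓡 m) x} : v ∈ leafTangent m (F.comap p) x ↔
      mfderiv (𝓡 m) (𝓡 n) p x v ∈ leafTangent n F (p x) := by
  refine ⟨mfderiv_mem_leafTangent hp.contMDiff, ?_⟩
  rintro ⟨δ, hδ, hδF, hδv⟩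
  obtain ⟨C⟩ := nonempty_fiberedChart hp x
  let u : 𝔼 m := mfderiv (𝓡 m) (𝓡 m) C.φ x v
  let c : ℝ → 𝔼 m := fun t => C.adjust (C.ψ (δ t), C.φ x + t • u)
  have velocity_c : tangentMap 𝓘(ℝ, ℝ) (𝓡 m) c ⟨0, (1 : ℝ)⟩ =
      tangentMap (𝓡 m) (𝓡 m) C.φ ⟨x, v⟩ :=
    C.velocity_adjust (hp.contMDiff.mdifferentiableAt (by simp))
      (hδ.mdifferentiableAt (by simp)) hδv rfl
  have c_zero : c 0 = C.φ x :=
    congr_arg (fun q : TangentBundle (𝓡 m) (𝔼 m) => q.proj) velocity_c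
  have δ_zero : δ 0 = p x := congr_arg (fun q : TangentBundle (𝓡 n) N => q.proj) hδv
  have contMDiffOn_c : ContMDiffOn 𝓘(ℝ, ℝ) (𝓡 m) ∞ c (δ ⁻¹' C.ψ.source) :=
    C.contMDiffOn_adjust (C.contMDiffOn_ψ.comp hδ.contMDiffOn subset_rfl)
      (contDiff_const.add (contDiff_id.smul contDiff_const)).contMDiff.contMDiffOn
  have isOpen_source : IsOpen (δ ⁻¹' C.ψ.source) := C.ψ.open_source.preimage hδ.continuous
  have zero_mem_source : (0 : ℝ) ∈ δ ⁻¹' C.ψ.source :=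
    Set.mem_preimage.2 (δ_zero ▸ C.mem_source_right)
  have zero_mem_target : c 0 ∈ C.φ.target := c_zero ▸ C.φ.map_source C.mem_source
  refine mem_leafTangent_of_local (γ := C.φ.symm ∘ c)
    (contMDiffOn_c.continuousOn.isOpen_inter_preimage isOpen_source C.φ.open_target)
    ⟨zero_mem_source, zero_mem_target⟩
    (C.contMDiffOn_φ_symm.comp' contMDiffOn_c) (fun t ht => ?_) ?_
  · change F (p (C.φ.symm (c t))) (p x)
    exact (C.apply_symm_adjust ht.1 ht.2).symm ▸ hδF t
  · have mdifferentiableAt_c : MDifferentiableAt 𝓘(ℝ, ℝ) (𝓡 m) c 0 :=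
      (contMDiffOn_c.contMDiffAt (isOpen_source.mem_nhds zero_mem_source)).mdifferentiableAt
        (by simp)
    rw [tangentMap_comp_at _
      (C.mdifferentiable_φ.mdifferentiableAt_symm zero_mem_target) mdifferentiableAt_c,
      velocity_c, tangentMap_symm_tangentMap C.mdifferentiable_φ C.mem_source]

theorem surjective_mfderiv (hp : Manifold.IsSubmersion (𝓡 m) (𝓡 n) ∞ p) (x : M) :
    Function.Surjective (mfderiv (𝓡 m) (𝓡 n) p x) := by
  obtain ⟨B, s, hB, hx, hs, hsx, hps⟩ := exists_local_section hp x
  have p_comp_s : p ∘ s =ᶠ[𝓝 (p x)] id := by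
    filter_upwards [hB.mem_nhds hx] with y hy using hps y hy
  have mfderiv_comp_s := mfderiv_comp (p x) (hp.contMDiff.mdifferentiable (by simp) (s (p x)))
    ((hs.contMDiffAt (hB.mem_nhds hx)).mdifferentiableAt (by simp))
  rw [p_comp_s.mfderiv_eq, mfderiv_id, hsx] at mfderiv_comp_s
  exact fun v => ⟨mfderiv (𝓡 n) (𝓡 m) s (p x) v, (DFunLike.congr_fun mfderiv_comp_s v).symm⟩

namespace FiberedChart

variable (C : FiberedChart m n p x)

/-- The lift of a vector field of `N` along `p`, over the domain of the chart `φ`: in the fibered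
chart, its value at each point is obtained from the constant vector `u` by `adjust`. -/
def liftField (Y : VField n N) (u : 𝔼 m) (y : M) : TangentBundle (𝓡 m) M :=
  tangentMap (𝓡 m) (𝓡 m) C.φ.symm
    ⟨C.φ y, C.adjust ((tangentMap (𝓡 n) (𝓡 n) C.ψ ⟨p y, Y (p y)⟩).2, u)⟩

theorem liftField_proj (Y : VField n N) (u : 𝔼 m) {y : M} (hy : y ∈ C.φ.source) :
    (C.liftField Y u y).proj = y :=
  C.φ.left_inv hy

theorem tangentMap_liftField (hp : MDifferentiable (𝓡 m) (𝓡 n) p) (Y : VField n N) (u : 𝔼 m)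
    {y : M} (hy : y ∈ C.φ.source) :
    tangentMap (𝓡 m) (𝓡 n) p (C.liftField Y u y) = ⟨p y, Y (p y)⟩ := by
  have proj_mem : (C.liftField Y u y).proj ∈ C.φ.source := (C.liftField_proj Y u hy).symm ▸ hy
  refine tangentMap_injOn C.mdifferentiable_ψ (C.mapsTo proj_mem) (C.mapsTo hy) ?_
  have tangentMap_φ : tangentMap (𝓡 m) (𝓡 m) C.φ (C.liftField Y u y) =
      ⟨C.φ y, C.adjust ((tangentMap (𝓡 n) (𝓡 n) C.ψ ⟨p y, Y (p y)⟩).2, u)⟩ :=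
    tangentMap_symm_tangentMap (e := C.φ.symm) C.mdifferentiable_φ.symm
      (q := ⟨C.φ y, _⟩) (C.φ.map_source hy)
  rw [C.tangentMap_tangentMap (hp _) proj_mem, tangentMap_φ, tangentMap_continuousLinearMap]
  exact (congr_arg (Bundle.TotalSpace.mk (C.π _)) (C.π_adjust _ u)).trans
    (mk_congr _ (C.apply_eq y hy).symm)

theorem liftField_self (hp : MDifferentiable (𝓡 m) (𝓡 n) p) {Y : VField n N}
    {v : TangentSpace (𝓡 m) x} (hv : mfderiv (𝓡 m) (𝓡 n) p x v = Y (p x)) {u : 𝔼 m}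
    (hu : mfderiv (𝓡 m) (𝓡 m) C.φ x v = u) : C.liftField Y u x = ⟨x, v⟩ := by
  have tangentMap_φ : tangentMap (𝓡 m) (𝓡 m) C.φ ⟨x, v⟩ = ⟨C.φ x, u⟩ :=
    congr_arg (Bundle.TotalSpace.mk (C.φ x)) hu
  have tangentMap_Y : tangentMap (𝓡 n) (𝓡 n) C.ψ ⟨p x, Y (p x)⟩ = ⟨C.π (C.φ x), C.π u⟩ := by
    rw [← hv, ← tangentMap_continuousLinearMap, ← tangentMap_φ]
    exact C.tangentMap_tangentMap (q := ⟨x, v⟩) (hp x) C.mem_source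
  rw [liftField, tangentMap_Y, C.adjust_π, ← tangentMap_φ,
    tangentMap_symm_tangentMap C.mdifferentiable_φ C.mem_source]

theorem contMDiffOn_liftField [IsManifold (𝓡 m) ∞ M] [IsManifold (𝓡 n) ∞ N]
    (hp : ContMDiff (𝓡 m) (𝓡 n) ∞ p) {Y : VField n N} (hY : IsSmoothField Y) (u : 𝔼 m) :
    ContMDiffOn (𝓡 m) (𝓡 m).tangent ∞ (C.liftField Y u) C.φ.source := by
  have contMDiffOn_Y : ContMDiffOn (𝓡 m) (𝓡 n) ∞
      (fun y => ((tangentMap (𝓡 n) (𝓡 n) C.ψ ⟨p y, Y (p y)⟩).2 : 𝔼 n)) C.φ.source :=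
    (contMDiff_snd_tangentBundle_modelSpace 𝔼 n (𝓡 n)).comp_contMDiffOn
      ((contMDiffOn_tangentMap C.contMDiffOn_ψ C.ψ.open_source).comp
        (hY.comp hp).contMDiffOn C.mapsTo)
  have contMDiffOn_model : ContMDiffOn (𝓡 m) (𝓡 m).tangent ∞
      (fun y => (⟨C.φ y, C.adjust ((tangentMap (𝓡 n) (𝓡 n) C.ψ ⟨p y, Y (p y)⟩).2, u)⟩ :
        TangentBundle (𝓡 m) 𝔼 m)) C.φ.source := by
    refine fun y hy => Bundle.contMDiffWithinAt_totalSpace.2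
      ⟨contMDiffOn_of_mem_maximalAtlas C.φ_mem_maximalAtlas y hy, ?_⟩
    convert! C.contMDiffOn_adjust contMDiffOn_Y (contMDiffOn_const (c := u)) y hy
    simp
  exact (contMDiffOn_tangentMap C.contMDiffOn_φ_symm C.φ.open_target).comp contMDiffOn_model
    fun y hy => C.φ.map_source hy

end FiberedChart

variable [IsManifold (𝓡 m) ∞ M] [IsManifold (𝓡 n) ∞ N]

theorem mfderiv_mem_tangentDistribution [T2Space N] (hp : Manifold.IsSubmersion (𝓡 m) (𝓡 n) ∞ p)
    {v : TangentSpace (𝓡 m) x} (hv : v ∈ tangentDistribution m (F.comap p) x) :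
    mfderiv (𝓡 m) (𝓡 n) p x v ∈ tangentDistribution n F (p x) := by
  obtain ⟨X, ⟨hX, hXF⟩, rfl⟩ := hv
  obtain ⟨B, s, hB, hx, hs, hsx, hps⟩ := exists_local_section hp x
  refine mem_tangentDistribution_of_local hB hx
    (σ := fun y => tangentMap (𝓡 m) (𝓡 n) p ⟨s y, X (s y)⟩)
    (((hp.contMDiff.contMDiff_tangentMap (m := ∞) (by simp)).comp hX).comp_contMDiffOn hs)
    hps (fun y _ => mfderiv_mem_leafTangent hp.contMDiff (hXF (s y))) ?_
  exact congr_arg (fun y => tangentMap (𝓡 m) (𝓡 n) p ⟨y, X y⟩) hsx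

theorem mem_tangentDistribution_comap [T2Space M] (hp : Manifold.IsSubmersion (𝓡 m) (𝓡 n) ∞ p)
    {v : TangentSpace (𝓡 m) x}
    (hv : mfderiv (𝓡 m) (𝓡 n) p x v ∈ tangentDistribution n F (p x)) :
    v ∈ tangentDistribution m (F.comap p) x := by
  obtain ⟨Y, ⟨hY, hYF⟩, hv⟩ := hv
  obtain ⟨C⟩ := nonempty_fiberedChart hp x
  have mdiff_p : MDifferentiable (𝓡 m) (𝓡 n) p := hp.contMDiff.mdifferentiable (by simp)
  let u : 𝔼 m := mfderiv (𝓡 m) (𝓡 m) C.φ x v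
  refine mem_tangentDistribution_of_local C.φ.open_source C.mem_source
    (C.contMDiffOn_liftField hp.contMDiff hY u) (fun y hy => C.liftField_proj Y u hy)
    (fun y hy => (mem_leafTangent_comap_iff hp).2 ?_) (C.liftField_self mdiff_p hv.symm rfl)
  change (tangentMap (𝓡 m) (𝓡 n) p (C.liftField Y u y)).2 ∈
    leafTangent n F (tangentMap (𝓡 m) (𝓡 n) p (C.liftField Y u y)).proj
  rw [C.tangentMap_liftField mdiff_p Y u hy]
  exact hYF (p y)

theorem mem_tangentDistribution_comap_iff [T2Space M] [T2Space N]
    (hp : Manifold.IsSubmersion (𝓡 m) (𝓡 n) ∞ p) {v : TangentSpace (𝓡 m) x} :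
    v ∈ tangentDistribution m (F.comap p) x ↔
      mfderiv (𝓡 m) (𝓡 n) p x v ∈ tangentDistribution n F (p x) :=
  ⟨mfderiv_mem_tangentDistribution hp, mem_tangentDistribution_comap hp⟩

end FiberedChart

section BasicForms

variable {n k : ℕ} {M : Type u} [TopologicalSpace M] [ChartedSpace 𝔼 n M]
  [IsManifold (𝓡 n) ∞ M] {F : Setoid M}

/-- The form `α` is annihilated by contraction with every vector field tangent to `F`. -/
def IsHorizontal (F : Setoid M) (α : RawForm n M k) : Prop :=
  ∀ x, VanishesAlong (α x) (tangentDistribution n F x)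

theorem isHorizontal_iff {α : RawForm n M k} :
    IsHorizontal F α ↔ ∀ X : VField n M, IsTangentField F X → ContractionVanishes X α := by
  cases k with
  | zero => exact ⟨fun _ _ _ => trivial, fun _ _ _ i => i.elim0⟩
  | succ k =>
    refine (forall_congr' fun x => vanishesAlong_iff_cons).trans
      ⟨fun hα X hX x v => hα x (X x) ⟨X, hX, rfl⟩ v, ?_⟩
    rintro hα x _ ⟨X, hX, rfl⟩ v
    exact hα X hX x v

-- For a horizontal form `α`, Cartan's formula reads `L_X α = ι_X (d α)`.
theorem isBasic_iff {α : RawForm n M k} (hα : IsSmoothForm α) :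
    IsBasic F α ↔ IsHorizontal F α ∧ IsHorizontal F (rawD α) := by
  simp only [isHorizontal_iff, IsBasic]
  constructor
  · exact fun h => ⟨fun X hX => (h X hX).1, fun X hX =>
      contractionVanishes_rawD hα hX.1 (h X hX).1 (h X hX).2⟩
  · exact fun ⟨hα₀, hα₁⟩ X hX => ⟨hα₀ X hX, fun x v =>
      (rawD_cons hα hX.1 (hα₀ X hX) x v).symm.trans (hα₁ X hX x v)⟩

end BasicForms

section PullbackBasicForms

variable {m n k : ℕ} {M N : Type u} [TopologicalSpace M] [ChartedSpace 𝔼 m M]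
  [TopologicalSpace N] [ChartedSpace 𝔼 n N] {p : M → N} {F : Setoid N}

theorem pullbackForm_injective (hp : Manifold.IsSubmersion (𝓡 m) (𝓡 n) ∞ p)
    (hps : Function.Surjective p) :
    Function.Injective (pullbackForm p : RawForm n N k → RawForm m M k) := by
  intro α β hαβ
  funext y
  obtain ⟨x, rfl⟩ := hps y
  exact compContinuousLinearMap_injective (surjective_mfderiv hp x) (congr_fun hαβ x)

variable [IsManifold (𝓡 m) ∞ M] [IsManifold (𝓡 n) ∞ N] [T2Space M]

theorem IsHorizontal.vanishesAlong_ker (hp : Manifold.IsSubmersion (𝓡 m) (𝓡 n) ∞ p)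
    {β : RawForm m M k} (hβ : IsHorizontal (F.comap p) β) (x : M) :
    VanishesAlong (β x) (mfderiv (𝓡 m) (𝓡 n) p x ⁻¹' {0}) :=
  (hβ x).mono fun _ hv => mem_tangentDistribution_comap hp
    ((Set.mem_singleton_iff.1 hv).symm ▸ zero_mem_tangentDistribution)

variable [T2Space N]

theorem isHorizontal_pullbackForm_iff (hp : Manifold.IsSubmersion (𝓡 m) (𝓡 n) ∞ p)
    (hps : Function.Surjective p) {α : RawForm n N k} :
    IsHorizontal (F.comap p) (pullbackForm p α : RawForm m M k) ↔ IsHorizontal F α := by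
  have vanishesAlong_iff : ∀ x, VanishesAlong ((pullbackForm p α : RawForm m M k) x)
      (tangentDistribution m (F.comap p) x) ↔
      VanishesAlong (α (p x)) (tangentDistribution n F (p x)) := fun x => by
    rw [show tangentDistribution m (F.comap p) x =
      mfderiv (𝓡 m) (𝓡 n) p x ⁻¹' tangentDistribution n F (p x) from
      Set.ext fun _ => mem_tangentDistribution_comap_iff hp]
    exact vanishesAlong_compContinuousLinearMap_iff (surjective_mfderiv hp x)
  exact (forall_congr' vanishesAlong_iff).trans
    (hps.forall (p := fun y => VanishesAlong (α y) (tangentDistribution n F y))).symm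

theorem isBasic_pullbackForm_iff (hp : Manifold.IsSubmersion (𝓡 m) (𝓡 n) ∞ p)
    (hps : Function.Surjective p) {α : RawForm n N k} (hα : IsSmoothForm α) :
    IsBasic (F.comap p) (pullbackForm p α : RawForm m M k) ↔ IsBasic F α := by
  rw [isBasic_iff hα, isBasic_iff (hα.pullbackForm hp.contMDiff),
    rawD_pullbackForm hα hp.contMDiff, isHorizontal_pullbackForm_iff hp hps,
    isHorizontal_pullbackForm_iff hp hps]

end PullbackBasicForms

section Descent

variable {m n k : ℕ} {M N : Type u} [TopologicalSpace M] [ChartedSpace 𝔼 m M]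
  [TopologicalSpace N] [ChartedSpace 𝔼 n N] {p : M → N} {F : Setoid N} {x₀ x : M}
  {β : RawForm m M k} {a : 𝔼 n [⋀^Fin k]→L[ℝ] ℝ}

/-- At the point `x`, the form `β` is the pullback along `p` of the alternating form `a` on the
model space of `N`, which stands for a form on the tangent space of `N` at `p x`. Values at
different points of a fiber of `p` can thus be compared. -/
def DescendsTo (p : M → N) (β : RawForm m M k) (a : 𝔼 n [⋀^Fin k]→L[ℝ] ℝ) (x : M) : Prop :=
  β x = a.compContinuousLinearMap (mfderiv (𝓡 m) (𝓡 n) p x : 𝔼 m →L[ℝ] 𝔼 n)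

namespace FiberedChart

variable (C : FiberedChart m n p x₀)

theorem eventually_contMDiffAt_φ_symm {z : 𝔼 m} (hz : z ∈ C.φ.target) :
    ∀ᶠ z' in 𝓝 z, ContMDiffAt (𝓡 m) (𝓡 m) ∞ C.φ.symm z' := by
  filter_upwards [C.φ.open_target.mem_nhds hz] with z' hz'
  exact C.contMDiffOn_φ_symm.contMDiffAt (C.φ.open_target.mem_nhds hz')

theorem π_mem_target {z : 𝔼 m} (hz : z ∈ C.φ.target) : C.π z ∈ C.ψ.target := by
  rw [← C.φ.right_inv hz, ← C.apply_eq _ (C.φ.map_target hz)]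
  exact C.ψ.map_source (C.mapsTo (C.φ.map_target hz))

theorem mfderiv_comp_φ_symm (hp : MDifferentiable (𝓡 m) (𝓡 n) p) {z : 𝔼 m}
    (hz : z ∈ C.φ.target) :
    (mfderiv (𝓡 m) (𝓡 n) p (C.φ.symm z) : 𝔼 m →L[ℝ] 𝔼 n).comp
        (mfderiv (𝓡 m) (𝓡 m) C.φ.symm z : 𝔼 m →L[ℝ] 𝔼 m) =
      (mfderiv (𝓡 n) (𝓡 n) C.ψ.symm (C.π z) : 𝔼 n →L[ℝ] 𝔼 n).comp C.π := by
  have comp_eq : p ∘ C.φ.symm =ᶠ[𝓝 z] C.ψ.symm ∘ C.π := by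
    filter_upwards [C.φ.open_target.mem_nhds hz] with z' hz' using C.apply_symm hz'
  refine (mfderiv_comp z (hp _) (C.mdifferentiable_φ.mdifferentiableAt_symm hz)).symm.trans
    (comp_eq.mfderiv_eq.trans ((mfderiv_comp z
      (C.mdifferentiable_ψ.mdifferentiableAt_symm (C.π_mem_target hz))
      C.π.mdifferentiableAt).trans ?_))
  exact congr_arg (ContinuousLinearMap.comp (mfderiv (𝓡 n) (𝓡 n) C.ψ.symm (C.π z)))
    C.π.mfderiv_eq

theorem descendsTo_iff (hp : MDifferentiable (𝓡 m) (𝓡 n) p) (hx : x ∈ C.φ.source) :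
    DescendsTo p β a x ↔ pullModel β C.φ.symm (C.φ x) = a.compContinuousLinearMap
      ((mfderiv (𝓡 n) (𝓡 n) C.ψ.symm (C.π (C.φ x)) : 𝔼 n →L[ℝ] 𝔼 n).comp C.π) := by
  have surjective_symm : Function.Surjective
      (mfderiv (𝓡 m) (𝓡 m) C.φ.symm (C.φ x) : 𝔼 m →L[ℝ] 𝔼 m) :=
    C.mdifferentiable_φ.symm.mfderiv_surjective (C.φ.map_source hx)
  have descendsTo_symm_iff : DescendsTo p β a (C.φ.symm (C.φ x)) ↔
      pullModel β C.φ.symm (C.φ x) = a.compContinuousLinearMap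
        ((mfderiv (𝓡 m) (𝓡 n) p (C.φ.symm (C.φ x)) : 𝔼 m →L[ℝ] 𝔼 n).comp
          (mfderiv (𝓡 m) (𝓡 m) C.φ.symm (C.φ x) : 𝔼 m →L[ℝ] 𝔼 m)) :=
    (compContinuousLinearMap_injective surjective_symm).eq_iff.symm
  rwa [C.mfderiv_comp_φ_symm hp (C.φ.map_source hx), C.φ.left_inv hx] at descendsTo_symm_iff

variable [IsManifold (𝓡 m) ∞ M] [IsManifold (𝓡 n) ∞ N] [T2Space M]

theorem vanishesAlong_pullModel (hp : Manifold.IsSubmersion (𝓡 m) (𝓡 n) ∞ p)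
    (hβ : IsHorizontal (F.comap p) β) {z w : 𝔼 m} (hz : z ∈ C.φ.target) (hw : C.π w = 0) :
    VanishesAlong (pullModel β C.φ.symm z) {w} := by
  refine ((hβ.vanishesAlong_ker hp _).compContinuousLinearMap _).mono
    (Set.singleton_subset_iff.2 ?_)
  have mfderiv_comp := DFunLike.congr_fun
    (C.mfderiv_comp_φ_symm (hp.contMDiff.mdifferentiable (by simp)) hz) w
  let D : 𝔼 n →L[ℝ] 𝔼 n := mfderiv (𝓡 n) (𝓡 n) C.ψ.symm (C.π z)
  exact mfderiv_comp.trans ((congr_arg D hw).trans D.map_zero)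

theorem fderiv_pullModel_apply_eq_zero (hp : Manifold.IsSubmersion (𝓡 m) (𝓡 n) ∞ p)
    (hβ : IsSmoothForm β) (hβF : IsBasic (F.comap p) β) {z w : 𝔼 m} (hz : z ∈ C.φ.target)
    (hw : C.π w = 0) : fderiv ℝ (pullModel β C.φ.symm) z w = 0 := by
  obtain ⟨horizontal_β, horizontal_dβ⟩ := (isBasic_iff hβ).1 hβF
  have smooth_symm := C.eventually_contMDiffAt_φ_symm hz
  refine fderiv_apply_eq_zero_of_vanishesAlong
    ((contDiffAt_pullModel hβ smooth_symm).differentiableAt (by simp)) ?_ ?_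
  · filter_upwards [C.φ.open_target.mem_nhds hz] with z' hz'
    exact C.vanishesAlong_pullModel hp horizontal_β hz' hw
  · rw [extDeriv_pullModel hβ smooth_symm]
    exact C.vanishesAlong_pullModel hp horizontal_dβ hz hw

theorem eventually_pullModel_eq (hp : Manifold.IsSubmersion (𝓡 m) (𝓡 n) ∞ p)
    (hβ : IsSmoothForm β) (hβF : IsBasic (F.comap p) β) :
    ∀ᶠ z in 𝓝 (C.φ x₀), C.π z = C.π (C.φ x₀) →
      pullModel β C.φ.symm z = pullModel β C.φ.symm (C.φ x₀) := by
  obtain ⟨ε, hε, ball_subset⟩ :=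
    Metric.isOpen_iff.1 C.φ.open_target _ (C.φ.map_source C.mem_source)
  filter_upwards [Metric.ball_mem_nhds _ hε] with z hz hπ
  refine eq_of_fderiv_apply_sub_eq_zero (convex_ball _ _) (fun y hy => ?_)
    (Metric.mem_ball_self hε) hz fun y hy => ?_
  · exact (contDiffAt_pullModel hβ
      (C.eventually_contMDiffAt_φ_symm (ball_subset hy))).differentiableAt (by simp)
  · exact C.fderiv_pullModel_apply_eq_zero hp hβ hβF (ball_subset hy)
      (by rw [map_sub, hπ, sub_self])

end FiberedChart

variable [IsManifold (𝓡 m) ∞ M] [IsManifold (𝓡 n) ∞ N]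

theorem isSmoothForm_of_pullbackForm (hp : Manifold.IsSubmersion (𝓡 m) (𝓡 n) ∞ p)
    (hps : Function.Surjective p) {α : RawForm n N k}
    (hα : IsSmoothForm (pullbackForm p α : RawForm m M k)) : IsSmoothForm α := by
  refine isSmoothForm_iff_contDiffAt.2 fun c y hy => ?_
  obtain ⟨x, hx⟩ := hps ((extChartAt (𝓡 n) c).symm y)
  obtain ⟨B, s, hB, hxB, hs, -, hpB⟩ := exists_local_section hp x
  rw [hx] at hxB
  have eventually_mem : ∀ᶠ z in 𝓝 y,
      z ∈ (extChartAt (𝓡 n) c).target ∧ (extChartAt (𝓡 n) c).symm z ∈ B :=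
    ((isOpen_extChartAt_target c).eventually_mem hy).and
      ((contMDiffAt_extChartAt_symm hy).continuousAt.eventually_mem (hB.mem_nhds hxB))
  have smooth_lift : ∀ᶠ z in 𝓝 y,
      ContMDiffAt (𝓡 n) (𝓡 m) ∞ (s ∘ (extChartAt (𝓡 n) c).symm) z := by
    filter_upwards [eventually_mem] with z hz
    exact (hs.contMDiffAt (hB.mem_nhds hz.2)).comp z (contMDiffAt_extChartAt_symm hz.1)
  refine (contDiffAt_pullModel hα smooth_lift).congr_of_eventuallyEq ?_
  filter_upwards [smooth_lift, eventually_mem.eventually_nhds] with z hz eventually_mem_z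
  rw [pullModel_pullbackForm (hp.contMDiff.mdifferentiableAt (by simp))
    (hz.mdifferentiableAt (by simp))]
  refine pullModel_congr α (g := (extChartAt (𝓡 n) c).symm) ?_
  filter_upwards [eventually_mem_z] with z' hz' using (hpB _ hz'.2).symm

variable [T2Space M]

theorem eventually_descendsTo_iff (hp : Manifold.IsSubmersion (𝓡 m) (𝓡 n) ∞ p)
    (hβ : IsSmoothForm β) (hβF : IsBasic (F.comap p) β) (x₀ : M) :
    ∀ᶠ x in 𝓝 x₀, p x = p x₀ → (DescendsTo p β a x ↔ DescendsTo p β a x₀) := by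
  obtain ⟨C⟩ := nonempty_fiberedChart hp x₀
  have mdiff_p : MDifferentiable (𝓡 m) (𝓡 n) p := hp.contMDiff.mdifferentiable (by simp)
  filter_upwards [(C.φ.continuousAt C.mem_source).eventually
    (C.eventually_pullModel_eq hp hβ hβF), C.φ.open_source.mem_nhds C.mem_source]
    with x pullModel_eq hx hpx
  have π_eq : C.π (C.φ x) = C.π (C.φ x₀) := by
    rw [← C.apply_eq x hx, ← C.apply_eq x₀ C.mem_source, hpx]
  rw [C.descendsTo_iff mdiff_p hx, C.descendsTo_iff mdiff_p C.mem_source, pullModel_eq π_eq, π_eq]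

theorem DescendsTo.of_apply_eq (h : DescendsTo p β a x₀) (hp : IsConnectedFiberSubmersion m n p)
    (hβ : IsSmoothForm β) (hβF : IsBasic (F.comap p) β) (hx : p x = p x₀) :
    DescendsTo p β a x := by
  have := Subtype.preconnectedSpace (hp.connected_fiber (p x₀)).isPreconnected
  have isLocallyConstant_descendsTo :
      IsLocallyConstant fun q : p ⁻¹' {p x₀} => DescendsTo p β a q := by
    rw [IsLocallyConstant.iff_eventually_eq]
    intro q
    filter_upwards [continuous_subtype_val.continuousAt.eventually
      (eventually_descendsTo_iff hp.isSubmersion hβ hβF q.1)] with q' hq'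
    exact propext (hq' (q'.2.trans q.2.symm))
  exact (isLocallyConstant_descendsTo.apply_eq_of_preconnectedSpace ⟨x₀, rfl⟩ ⟨x, hx⟩).mp h

theorem IsHorizontal.exists_descendsTo (hp : Manifold.IsSubmersion (𝓡 m) (𝓡 n) ∞ p)
    (hβ : IsHorizontal (F.comap p) β) (x : M) :
    ∃ a : 𝔼 n [⋀^Fin k]→L[ℝ] ℝ, DescendsTo p β a x := by
  let A : 𝔼 m →L[ℝ] 𝔼 n := mfderiv (𝓡 m) (𝓡 n) p x
  obtain ⟨H, hH⟩ := A.exists_rightInverse_of_surjective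
    (LinearMap.range_eq_top.2 (surjective_mfderiv hp x))
  exact ⟨_, ((hβ.vanishesAlong_ker hp x).compContinuousLinearMap_comp (A := A) (H := H)
    (DFunLike.congr_fun hH)).symm⟩

theorem exists_pullbackForm_eq (hp : IsConnectedFiberSubmersion m n p) (hβ : IsSmoothForm β)
    (hβF : IsBasic (F.comap p) β) :
    ∃ α : RawForm n N k, (pullbackForm p α : RawForm m M k) = β := by
  have exists_descendsTo_fiber : ∀ y : N, ∃ a : 𝔼 n [⋀^Fin k]→L[ℝ] ℝ,
      ∀ x, p x = y → DescendsTo p β a x := by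
    intro y
    obtain ⟨x₀, rfl⟩ := hp.surjective y
    obtain ⟨a, ha⟩ := ((isBasic_iff hβ).1 hβF).1.exists_descendsTo hp.isSubmersion x₀
    exact ⟨a, fun x hx => ha.of_apply_eq hp hβ hβF hx⟩
  choose α hα using exists_descendsTo_fiber
  exact ⟨α, funext fun x => (hα (p x) x rfl).symm⟩

variable [T2Space N]

/-- The pullback along `p`, as a linear map from the basic forms of `F` to those of `p⁻¹ F`. -/
def basicPullback (hp : IsConnectedFiberSubmersion m n p) (F : Setoid N) (k : ℕ) :
    basicForms n F k →ₗ[ℝ] basicForms m (F.comap p) k where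
  toFun α := ⟨pullbackForm p α.1, α.2.1.pullbackForm hp.isSubmersion.contMDiff,
    (isBasic_pullbackForm_iff hp.isSubmersion hp.surjective α.2.1).2 α.2.2⟩
  map_add' _ _ := rfl
  map_smul' _ _ := rfl

theorem basicPullback_bijective (hp : IsConnectedFiberSubmersion m n p) (F : Setoid N) (k : ℕ) :
    Function.Bijective (basicPullback hp F k) := by
  refine ⟨fun α α' h => Subtype.ext (pullbackForm_injective hp.isSubmersion hp.surjective
    (congr_arg Subtype.val h)), ?_⟩
  rintro ⟨β, hβ, hβF⟩
  obtain ⟨α, rfl⟩ := exists_pullbackForm_eq hp hβ hβF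
  have hα : IsSmoothForm α := isSmoothForm_of_pullbackForm hp.isSubmersion hp.surjective hβ
  exact ⟨⟨α, hα, (isBasic_pullbackForm_iff hp.isSubmersion hp.surjective hα).1 hβF⟩, rfl⟩

/-- The pullback along `p`, as an isomorphism of complexes of basic forms. -/
def basicComplexIso (hp : IsConnectedFiberSubmersion m n p) (F : Setoid N) :
    basicComplex n F ≅ basicComplex m (F.comap p) :=
  HomologicalComplex.Hom.isoOfComponents (fun k =>
    (LinearEquiv.ofBijective _ (basicPullback_bijective hp F k)).toModuleIso) (by
    rintro i _ rfl
    simp only [basicComplex, CochainComplex.of_d]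
    ext α
    exact congr_arg (fun η : RawForm m M (i + 1) => η _ _)
      (rawD_pullbackForm α.2.1 hp.isSubmersion.contMDiff))

end Descent

end Foliation

end

theorem corollary4_general :
    (∀ (m n : ℕ) (M N : Type u)
      [TopologicalSpace M] [ChartedSpace (EuclideanSpace ℝ (Fin m)) M] [IsManifold (𝓡 m) ∞ M]
      [T2Space M]
      [TopologicalSpace N] [ChartedSpace (EuclideanSpace ℝ (Fin n)) N] [IsManifold (𝓡 n) ∞ N]
      [T2Space N]
      (p : M → N) (F : Setoid N), IsConnectedFiberSubmersion m n p →
      ∃ e : basicComplex n F ≅ basicComplex m (F.comap p),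
        ∀ (k : ℕ) (α : basicForms n F k),
          ((e.hom.f k).hom α : basicForms m (F.comap p) k).1 = pullbackForm p α.1) ∧
    (∀ (m n₀ n₁ : ℕ) (M N₀ N₁ : Type u)
      [TopologicalSpace M] [ChartedSpace (EuclideanSpace ℝ (Fin m)) M] [IsManifold (𝓡 m) ∞ M]
      [T2Space M]
      [TopologicalSpace N₀] [ChartedSpace (EuclideanSpace ℝ (Fin n₀)) N₀]
      [IsManifold (𝓡 n₀) ∞ N₀] [T2Space N₀]
      [TopologicalSpace N₁] [ChartedSpace (EuclideanSpace ℝ (Fin n₁)) N₁]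
      [IsManifold (𝓡 n₁) ∞ N₁] [T2Space N₁]
      (p₀ : M → N₀) (p₁ : M → N₁) (F₀ : Setoid N₀) (F₁ : Setoid N₁),
      IsConnectedFiberSubmersion m n₀ p₀ → IsConnectedFiberSubmersion m n₁ p₁ →
      F₀.comap p₀ = F₁.comap p₁ →
      Nonempty (basicComplex n₀ F₀ ≅ basicComplex n₁ F₁) ∧
      ∀ k : ℕ, Nonempty (basicCohomology n₀ F₀ k ≅ basicCohomology n₁ F₁ k)) := by
  refine ⟨fun _ _ _ _ _ _ _ _ _ _ _ _ _ F hp => ⟨basicComplexIso hp F, fun _ _ => rfl⟩, ?_⟩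
  intro m n₀ n₁ M N₀ N₁ _ _ _ _ _ _ _ _ _ _ _ _ p₀ p₁ F₀ F₁ hp₀ hp₁ comap_eq
  have complexIso : basicComplex n₀ F₀ ≅ basicComplex n₁ F₁ := basicComplexIso hp₀ F₀ ≪≫
    eqToIso (by rw [comap_eq]) ≪≫ (basicComplexIso hp₁ F₁).symm
  exact ⟨⟨complexIso⟩, fun k => ⟨(HomologicalComplex.homologyFunctor _ _ k).mapIso complexIso⟩⟩

theorem corollary4 :
    (∀ (m n : ℕ) (M N : Type u)
      [TopologicalSpace M] [ChartedSpace (EuclideanSpace ℝ (Fin m)) M] [IsManifold (𝓡 m) ∞ M]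
      [T2Space M] [SecondCountableTopology M]
      [TopologicalSpace N] [ChartedSpace (EuclideanSpace ℝ (Fin n)) N] [IsManifold (𝓡 n) ∞ N]
      [T2Space N] [SecondCountableTopology N]
      (p : M → N) (F : Setoid N),
      IsConnectedFiberSubmersion m n p → IsSingularFoliation n F →
      ∃ e : basicComplex n F ≅ basicComplex m (F.comap p),
        ∀ (k : ℕ) (α : basicForms n F k),
          ((e.hom.f k).hom α : basicForms m (F.comap p) k).1 = pullbackForm p α.1) ∧
    (∀ (n₀ n₁ : ℕ) (N₀ N₁ : Type u)
      [TopologicalSpace N₀] [ChartedSpace (EuclideanSpace ℝ (Fin n₀)) N₀]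
      [IsManifold (𝓡 n₀) ∞ N₀] [T2Space N₀] [SecondCountableTopology N₀]
      [TopologicalSpace N₁] [ChartedSpace (EuclideanSpace ℝ (Fin n₁)) N₁]
      [IsManifold (𝓡 n₁) ∞ N₁] [T2Space N₁] [SecondCountableTopology N₁]
      (F₀ : Setoid N₀) (F₁ : Setoid N₁),
      IsSingularFoliation n₀ F₀ → IsSingularFoliation n₁ F₁ → IsMolinoEquivalent n₀ n₁ F₀ F₁ →
      Nonempty (basicComplex n₀ F₀ ≅ basicComplex n₁ F₁) ∧
      ∀ k : ℕ, Nonempty (basicCohomology n₀ F₀ k ≅ basicCohomology n₁ F₁ k)) := by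
  refine ⟨fun m n M N _ _ _ _ _ _ _ _ _ _ p F hp _ => corollary4_general.1 m n M N p F hp, ?_⟩
  rintro _ _ _ _ _ _ _ _ _ _ _ _ _ _ _ _ - - ⟨_, _, _, _, _, _, _, _, _, _, -, hp₀, hp₁, h₀, h₁⟩
  exact corollary4_general.2 _ _ _ _ _ _ _ _ _ _ hp₀ hp₁ (h₀.trans h₁.symm)
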